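/- Let $n\ge 1$, $\alpha\in(1/2,1)$, $L>0$. For $0<\beta<1$ put ${}_0I_t^{\beta}u(t)=\frac1{\Gamma(\beta)}\int_0^t (t-s)^{\beta-1}u(s)\,ds$ and ${}_tI_L^{\beta}g(t)=\frac1{\Gamma(\beta)}\int_t^L (s-t)^{\beta-1}g(s)\,ds$, and let ${}_0D_t^\alpha u=\frac{d}{dt}\,{}_0I_t^{1-\alpha}u$ and ${}_tD_L^\alpha g=-\frac{d}{dt}\,{}_tI_L^{1-\alpha}g$ be the Riemann–Liouville derivatives. Let $E_0^\alpha$ be the closure of $C_c^\infty((0,L),\mathbb R^n)$ with respect to the norm $\big(\int_0^L|u|^2dt+\int_0^L|{}_0D_t^\alpha u|^2dt\big)^{1/2}$. Let $W\in C^1([0,L]\times\mathbb R^n,\mathbb R)$, write $\nabla W(t,x)$ for the gradient in $x$, and suppose that - $(W_1)$ there is $\theta>2$ such that $0<\theta W(t,x)\le\langle\nabla W(t,x),x\rangle$ for all $t\in[0,L]$ and $x\ne0$; - $(W_2)$ $|\nabla W(t,x)|=o(|x|)$ as $|x|\to0$, uniformly in $t\in[0,L]$; - $(W_3)$ there is $\overline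 W\in C(\mathbb R^n,\mathbb R)$ with $|W(t,x)|+|\nabla W(t,x)|\le|\overline W(x)|$ for all $t\in[0,L]$ and $x\in\mathbb R^n$; - $(W_4)$ for all $t\in[0,L]$ and $q\neq0$ the function $s\mapsto\langle\nabla W(t,sq),q\rangle/s^{\theta-1}$ is strictly increasing on $(0,\infty)$, with $\theta$ as in $(W_1)$. For $u,v\in E_0^\alpha$ let $$I(u)=\tfrac12\int_0^L|{}_0D_t^\alpha u|^2dt-\int_0^LW(t,u)\,dt,\qquad I'(u)v=\int_0^L\langle{}_0D_t^\alpha u,{}_0D_t^\alpha v\rangle dt-\int_0^L\langle\nabla W(t,u),v\rangle dt,$$ $$\tilde{\mathcal N}=\{u\in E_0^\alpha\setminus\{0\}: I'(u)u=0\},\qquad \tilde c=\inf_{\tilde{\mathcal N}}I .$$ Then the fractional boundary value problem $${}_tD_L^\alpha\,{}_0D_t^\alpha u=\nabla W(t,u)\quad\text{on }(0,L),\qquad u(0)=u(L)=0,$$ has a ground state solution: there is $u\in E_0^\alpha\setminus\{0\}$, continuous on $[0,L]$ with $u(0)=u(L)=0$, for which both fractional derivatives exist and the equation holds at every $t\in(0,L)$,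 such that $I'(u)v=0$ for all $v\in E_0^\alpha$ and $I(u)=\tilde c=\min_{\tilde{\mathcal N}}I$. -/

import Mathlib

open Set Filter Topology MeasureTheory
open scoped ContDiff Gradient

namespace FracBVP

/-- `ℝⁿ` with its Euclidean norm. -/
abbrev Vec (n : ℕ) : Type := EuclideanSpace ℝ (Fin n)

noncomputable section

/-- Left Riemann–Liouville fractional integral of order `β` based at `0`:
`(₀I_t^β u)(t) = Γ(β)⁻¹ ∫₀ᵗ (t - s)^(β - 1) u(s) ds`. -/
def leftInt {n : ℕ} (β : ℝ) (u : ℝ → Vec n) (t : ℝ) : Vec n :=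
  (Real.Gamma β)⁻¹ • ∫ s in (0 : ℝ)..t, (t - s) ^ (β - 1) • u s

/-- Right Riemann–Liouville fractional integral of order `β` based at `L`:
`(ₜI_L^β g)(t) = Γ(β)⁻¹ ∫ₜᴸ (s - t)^(β - 1) g(s) ds`. -/
def rightInt {n : ℕ} (β L : ℝ) (g : ℝ → Vec n) (t : ℝ) : Vec n :=
  (Real.Gamma β)⁻¹ • ∫ s in t..L, (s - t) ^ (β - 1) • g s

/-- Left Riemann–Liouville derivative `₀D_t^α u = d/dt ₀I_t^(1-α) u`, for `0 < α < 1`. -/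
def leftDeriv {n : ℕ} (α : ℝ) (u : ℝ → Vec n) (t : ℝ) : Vec n :=
  deriv (leftInt (1 - α) u) t

/-- Right Riemann–Liouville derivative `ₜD_L^α g = - d/dt ₜI_L^(1-α) g`, for `0 < α < 1`. -/
def rightDeriv {n : ℕ} (α L : ℝ) (g : ℝ → Vec n) (t : ℝ) : Vec n :=
  -deriv (rightInt (1 - α) L g) t

/-- Lebesgue measure on `(0, L)`. -/
def vol (L : ℝ) : Measure ℝ := volume.restrict (Ioo 0 L)

/-- Smooth functions with compact support in `(0, L)`. -/
def IsTest {n : ℕ} (L : ℝ) (φ : ℝ → Vec n) : Prop :=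
  ContDiff ℝ ∞ φ ∧ HasCompactSupport φ ∧ tsupport φ ⊆ Ioo 0 L

/-- The space `E₀^α`: closure of the test functions for the norm
`(‖u‖²_{L²(0,L)} + ‖₀D_t^α u‖²_{L²(0,L)})^(1/2)`. Elements are functions, of which only the
almost-everywhere class on `(0, L)` matters. -/
def E0 {n : ℕ} (α L : ℝ) : Set (ℝ → Vec n) :=
  {u | MemLp u 2 (vol L) ∧ MemLp (leftDeriv α u) 2 (vol L) ∧
    ∃ φ : ℕ → ℝ → Vec n, (∀ k, IsTest L (φ k)) ∧
      Tendsto (fun k => eLpNorm (fun t => φ k t - u t) 2 (vol L)) atTop (𝓝 0) ∧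
      Tendsto (fun k => eLpNorm (fun t => leftDeriv α (φ k) t - leftDeriv α u t) 2 (vol L))
        atTop (𝓝 0)}

/-- Conditions (W₁)–(W₄) for `t ∈ [0, L]`; `∇ (W t) x` is the gradient in the space variable. -/
structure Conditions {n : ℕ} (L θ : ℝ) (W : ℝ → Vec n → ℝ) : Prop where
  contDiff : ContDiffOn ℝ 1 (fun p : ℝ × Vec n => W p.1 p.2) (Icc 0 L ×ˢ univ)
  two_lt : 2 < θ
  ambrosetti_rabinowitz : ∀ t ∈ Icc 0 L, ∀ x : Vec n, x ≠ 0 →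
    0 < θ * W t x ∧ θ * W t x ≤ inner ℝ (∇ (W t) x) x
  small_o : ∀ ε > 0, ∃ δ > 0, ∀ t ∈ Icc 0 L, ∀ x : Vec n, ‖x‖ < δ → ‖∇ (W t) x‖ ≤ ε * ‖x‖
  growth : ∃ Wbar : Vec n → ℝ, Continuous Wbar ∧
    ∀ t ∈ Icc 0 L, ∀ x : Vec n, |W t x| + ‖∇ (W t) x‖ ≤ |Wbar x|
  strictMono : ∀ t ∈ Icc 0 L, ∀ q : Vec n, q ≠ 0 →
    StrictMonoOn (fun s : ℝ => inner ℝ (∇ (W t) (s • q)) q / s ^ (θ - 1)) (Ioi 0)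

/-- `I(u) = ½ ∫₀ᴸ |₀D_t^α u|² dt - ∫₀ᴸ W(t, u) dt`. -/
def energy {n : ℕ} (α L : ℝ) (W : ℝ → Vec n → ℝ) (u : ℝ → Vec n) : ℝ :=
  (1 / 2) * (∫ t in (0 : ℝ)..L, ‖leftDeriv α u t‖ ^ 2) - ∫ t in (0 : ℝ)..L, W t (u t)

/-- `I'(u)v = ∫₀ᴸ ⟨₀D_t^α u, ₀D_t^α v⟩ dt - ∫₀ᴸ ⟨∇W(t, u), v⟩ dt`. -/
def energyDeriv {n : ℕ} (α L : ℝ) (W : ℝ → Vec n → ℝ) (u v : ℝ → Vec n) : ℝ :=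
  (∫ t in (0 : ℝ)..L, inner ℝ (leftDeriv α u t) (leftDeriv α v t)) -
    ∫ t in (0 : ℝ)..L, inner ℝ (∇ (W t) (u t)) (v t)

/-- The Nehari manifold `{u ∈ E₀^α \ {0} : I'(u)u = 0}`. -/
def nehari {n : ℕ} (α L : ℝ) (W : ℝ → Vec n → ℝ) : Set (ℝ → Vec n) :=
  {u | u ∈ E0 α L ∧ ¬ (u =ᵐ[vol L] 0) ∧ energyDeriv α L W u u = 0}

/-- `c̃ = inf I` over the Nehari manifold. -/
def nehariLevel {n : ℕ} (α L : ℝ) (W : ℝ → Vec n → ℝ) : ℝ :=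
  sInf (energy α L W '' nehari α L W)

/-- `u` solves `ₜD_L^α ₀D_t^α u = ∇W(t, u)` on `(0, L)`, `u(0) = u(L) = 0`; both fractional
derivatives exist at every point of `(0, L)`. -/
structure IsSolution {n : ℕ} (α L : ℝ) (W : ℝ → Vec n → ℝ) (u : ℝ → Vec n) : Prop where
  continuousOn : ContinuousOn u (Icc 0 L)
  left : u 0 = 0
  right : u L = 0
  diff_left : ∀ t ∈ Ioo 0 L, DifferentiableAt ℝ (leftInt (1 - α) u) t
  diff_right : ∀ t ∈ Ioo 0 L, DifferentiableAt ℝ (rightInt (1 - α) L (leftDeriv α u)) t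
  equation : ∀ t ∈ Ioo 0 L, rightDeriv α L (leftDeriv α u) t = ∇ (W t) (u t)

/-- A ground state: a nonzero critical point of `I` on `E₀^α` that minimizes `I` over the
Nehari manifold (hence over all nonzero critical points). -/
structure IsGroundState {n : ℕ} (α L : ℝ) (W : ℝ → Vec n → ℝ) (u : ℝ → Vec n) : Prop where
  mem : u ∈ E0 α L
  ne_zero : ¬ (u =ᵐ[vol L] 0)
  critical : ∀ v ∈ E0 α L, energyDeriv α L W u v = 0
  least : IsLeast (energy α L W '' nehari α L W) (energy α L W u)

end

end FracBVP

/-! The map sending `u` to `g = ₀D_t^α u` identifies `E₀^α`, up to null sets, with the `L²`-closure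
`derivSpace` of the fractional derivatives of test functions; its inverse is `leftInt α`. In this
Hilbert space the energy is `½‖g‖² - Ψ(g)`, with `Ψ` the potential part. Since `α > 1/2`, the kernel
of `leftInt α` is square integrable, so evaluation of `leftInt α g` at a point is a bounded linear
map, uniformly in the point. Weak convergence of `g` therefore gives bounded pointwise convergence
of the paths, and dominated convergence makes `Ψ` and its derivative weakly sequentially continuous.
This plays the role of a compact embedding.

The ground state comes from an abstract theorem, `Superquadratic.exists_groundState`. By (W₁) and
(W₂) a minimizing sequence on the Nehari set is bounded and stays away from `0`. Its weak limit,
rescaled back to the Nehari set, is a minimizer because the action is maximal along rays at Nehari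
points, by (W₄). With `W` only `C¹` the Nehari set need not be a manifold, so Lagrange multipliers
are avoided: a direction of descent at the minimizer could be followed and rescaled back to the
Nehari set with strictly smaller action.

The pointwise equation follows by duality. With `f = ∇W(t, u)`, fractional integration by parts
shows that `g - ₜI_L^α f` is orthogonal to `₀D_t^α φ = ₀I_t^(1-α) φ'` for all test `φ`. The du
Bois-Reymond lemma makes its right integral of order `1 - α` a constant `c`. Inverting gives `₀D_t^α
u = ₜI_L^α f + c (L - t)^(α-1) / Γ(α)` at every interior point. The right integral of order `1 - α`
of this is `∫ₜᴸ f + c`, whose derivative is `-f`. -/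

namespace FracBVP

/-! ### Abstract minimization on the Nehari set in a Hilbert space -/

section Nehari

variable {H : Type*} [NormedAddCommGroup H] [InnerProductSpace ℝ H]

/-- Weak sequential convergence in a real Hilbert space. -/
def WeakTendsto (g : ℕ → H) (w : H) : Prop :=
  ∀ v, Tendsto (fun k => inner ℝ (g k) v) atTop (𝓝 (inner ℝ w v))

lemma WeakTendsto.of_tendsto {g : ℕ → H} {w : H} (h : Tendsto g atTop (𝓝 w)) :
    WeakTendsto g w := fun _ => h.inner tendsto_const_nhds

lemma WeakTendsto.const_smul {g : ℕ → H} {w : H} (h : WeakTendsto g w) (c : ℝ) :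
    WeakTendsto (fun k => c • g k) (c • w) := fun v => by
  simpa [inner_smul_left] using (h v).const_mul c

/-- Bounded sequences in a separable Hilbert space have weakly convergent subsequences. -/
lemma exists_weakTendsto_subseq [CompleteSpace H] [TopologicalSpace.SeparableSpace H]
    {g : ℕ → H} {R : ℝ} (hg : ∀ k, ‖g k‖ ≤ R) :
    ∃ (w : H) (m : ℕ → ℕ), StrictMono m ∧ WeakTendsto (fun k => g (m k)) w := by
  have hs := WeakDual.isSeqCompact_closedBall ℝ H (0 : StrongDual ℝ H) R
  obtain ⟨ℓ, -, m, hm, hlim⟩ := hs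
    (x := fun k => StrongDual.toWeakDual (InnerProductSpace.toDual ℝ H (g k))) (fun k => by
      simpa using hg k)
  refine ⟨(InnerProductSpace.toDual ℝ H).symm (WeakDual.toStrongDual ℓ), m, hm, fun v => ?_⟩
  have h1 := ((WeakDual.eval_continuous v).tendsto ℓ).comp hlim
  rw [InnerProductSpace.toDual_symm_apply]
  exact h1

/-- A functional `Ψ` with directional derivatives `B`, weakly sequentially continuous, superquadratic
with exponent `θ` and strictly monotone along rays. -/
structure Superquadratic (θ : ℝ) (Ψ : H → ℝ) (B : H → H → ℝ) : Prop where
  two_lt : 2 < θ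
  smul_right : ∀ g (c : ℝ) v, B g (c • v) = c * B g v
  hasDerivAt : ∀ g v (s : ℝ), HasDerivAt (fun s : ℝ => Ψ (g + s • v)) (B (g + s • v) v) s
  weak_cont : ∀ {g : ℕ → H} {w : H}, WeakTendsto g w →
    Tendsto (fun k => Ψ (g k)) atTop (𝓝 (Ψ w))
  weak_cont_deriv : ∀ {g h : ℕ → H} {w v : H}, WeakTendsto g w → WeakTendsto h v →
    Tendsto (fun k => B (g k) (h k)) atTop (𝓝 (B w v))
  nonneg : ∀ g, 0 ≤ Ψ g
  le_deriv : ∀ g, θ * Ψ g ≤ B g g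
  small : ∀ ε > 0, ∃ δ > 0, ∀ g, ‖g‖ < δ → B g g ≤ ε * ‖g‖ ^ 2
  strictMono : ∀ g, g ≠ 0 → StrictMonoOn (fun s : ℝ => B (s • g) g / s ^ (θ - 1)) (Ioi 0)

/-- The quadratic functional perturbed by `Ψ`. -/
noncomputable def action (Ψ : H → ℝ) (w : H) : ℝ := 1 / 2 * ‖w‖ ^ 2 - Ψ w

namespace Superquadratic

variable {θ : ℝ} {Ψ : H → ℝ} {B : H → H → ℝ} (h : Superquadratic θ Ψ B)
include h

/-- Norm convergence implies weak convergence, so weak sequential continuity already contains joint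
norm continuity. -/
lemma continuous_deriv : Continuous (fun p : H × H => B p.1 p.2) := by
  rw [continuous_iff_seqContinuous]
  intro x p hx
  exact h.weak_cont_deriv (.of_tendsto ((continuous_fst.tendsto p).comp hx))
    (.of_tendsto ((continuous_snd.tendsto p).comp hx))

lemma continuous_ray (g : H) : Continuous (fun s : ℝ => B (s • g) g) :=
  h.continuous_deriv.comp (f := fun s : ℝ => (s • g, g)) (by fun_prop)

lemma hasDerivAt_action (g v : H) (s : ℝ) :
    HasDerivAt (fun s : ℝ => action Ψ (g + s • v))
      (inner ℝ (g + s • v) v - B (g + s • v) v) s := by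
  have h1 : HasDerivAt (fun s : ℝ => g + s • v) v s := by
    simpa using ((hasDerivAt_id s).smul_const v).const_add g
  have h2 := (h1.norm_sq.const_mul (1 / 2 : ℝ)).sub (h.hasDerivAt g v s)
  rw [show ∀ x : ℝ, 1 / 2 * (2 * x) = x by intro x; ring] at h2
  exact h2

lemma deriv_nonneg (g : H) : 0 ≤ B g g :=
  le_trans (mul_nonneg (by linarith [h.two_lt]) (h.nonneg g)) (h.le_deriv g)

lemma deriv_ray_nonneg (g : H) {s : ℝ} (hs : 0 < s) : 0 ≤ B (s • g) g := by
  have := h.deriv_nonneg (s • g)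
  rw [h.smul_right] at this
  exact nonneg_of_mul_nonneg_right this hs

/-- The ray quotient is nonnegative at `s = 1/2` and strictly larger at `s = 1`. -/
lemma deriv_pos {g : H} (hg : g ≠ 0) : 0 < B g g := by
  have h1 := h.strictMono g hg (a := 1 / 2) (b := 1) (by simp) (by simp) (by norm_num)
  simp only [one_smul, Real.one_rpow, div_one] at h1
  exact lt_of_le_of_lt (div_nonneg (h.deriv_ray_nonneg g (by norm_num)) (by positivity)) h1

/-- Since `θ - 1 > 1`, `s ^ (θ - 1) < s` for `s < 1`. Together with `lt_deriv_ray` this fixes the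
sign of the action's derivative along the ray through a Nehari point on either side of `1`. -/
lemma deriv_ray_lt {g : H} (hg : g ≠ 0) {s : ℝ} (hs : 0 < s) (hs1 : s < 1) :
    B (s • g) g < s * B g g := by
  have h1 := h.strictMono g hg (a := s) (b := 1) hs (by simp) hs1
  simp only [one_smul, Real.one_rpow, div_one] at h1
  rw [div_lt_iff₀ (by positivity)] at h1
  refine h1.trans ?_
  rw [mul_comm]
  gcongr
  · exact h.deriv_pos hg
  · have := Real.rpow_lt_rpow_of_exponent_gt hs hs1 (show (1 : ℝ) < θ - 1 by linarith [h.two_lt])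
    simpa using this

lemma le_deriv_ray {g : H} (hg : g ≠ 0) {s : ℝ} (hs1 : 1 < s) :
    s ^ (θ - 1) * B g g < B (s • g) g := by
  have hs : 0 < s := by linarith
  have h1 := h.strictMono g hg (a := 1) (b := s) (by simp) hs hs1
  simp only [one_smul, Real.one_rpow, div_one] at h1
  rwa [lt_div_iff₀ (by positivity), mul_comm] at h1

lemma lt_deriv_ray {g : H} (hg : g ≠ 0) {s : ℝ} (hs1 : 1 < s) :
    s * B g g < B (s • g) g := by
  refine lt_of_le_of_lt ?_ (h.le_deriv_ray hg hs1)
  gcongr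
  · exact h.deriv_nonneg g
  · have := Real.rpow_le_rpow_of_exponent_le hs1.le (show (1 : ℝ) ≤ θ - 1 by linarith [h.two_lt])
    simpa using this

/-- Intermediate values of `B (s • g) g - s * ‖g‖ ^ 2`: nonpositive for small `s` by `small`,
nonnegative at `s = 1` by hypothesis. -/
lemma exists_ray_mem {g : H} (hg : g ≠ 0) (hle : ‖g‖ ^ 2 ≤ B g g) :
    ∃ s : ℝ, 0 < s ∧ s ≤ 1 ∧ ‖s • g‖ ^ 2 = B (s • g) (s • g) := by
  obtain ⟨δ, hδ, hsm⟩ := h.small (1 / 2) (by norm_num)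
  have hg' : 0 < ‖g‖ := norm_pos_iff.2 hg
  set r := min (δ / (2 * ‖g‖)) 1
  have hr : 0 < r := by positivity
  have hr1 : r ≤ 1 := min_le_right _ _
  have hrd : ‖r • g‖ < δ := by
    rw [norm_smul, Real.norm_of_nonneg hr.le]
    calc r * ‖g‖ ≤ δ / (2 * ‖g‖) * ‖g‖ := by gcongr; exact min_le_left _ _
      _ = δ / 2 := by field_simp
      _ < δ := by linarith
  have h1 := hsm _ hrd
  rw [h.smul_right, norm_smul, Real.norm_of_nonneg hr.le] at h1
  have hcont : ContinuousOn (fun s : ℝ => B (s • g) g - s * ‖g‖ ^ 2) (Icc r 1) :=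
    ((h.continuous_ray g).sub (by fun_prop)).continuousOn
  have hmem : (0 : ℝ) ∈ Icc (B (r • g) g - r * ‖g‖ ^ 2) (B ((1 : ℝ) • g) g - 1 * ‖g‖ ^ 2) := by
    constructor
    · have : r * B (r • g) g ≤ r * (r * ‖g‖ ^ 2) := by nlinarith [sq_nonneg (r * ‖g‖)]
      linarith [le_of_mul_le_mul_left this hr]
    · simp only [one_smul]; linarith
  obtain ⟨s, hs, hs0⟩ := intermediate_value_Icc hr1 hcont hmem
  have hs' : 0 < s := hr.trans_le hs.1
  refine ⟨s, hs', hs.2, ?_⟩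
  rw [h.smul_right, norm_smul, Real.norm_of_nonneg hs'.le]
  simp only at hs0
  rw [show B (s • g) g = s * ‖g‖ ^ 2 by linarith]
  ring

/-- Along a ray `B (s • g) (s • g)` grows at least like `s ^ θ`, which beats `s ^ 2 * ‖g‖ ^ 2`; far
out, `exists_ray_mem` applies. -/
lemma exists_mem_nehari [Nontrivial H] : ∃ g : H, g ≠ 0 ∧ ‖g‖ ^ 2 = B g g := by
  obtain ⟨g, hg⟩ := exists_ne (0 : H)
  have hB := h.deriv_pos hg
  obtain ⟨s, hs1, hs⟩ : ∃ s : ℝ, 1 < s ∧ ‖g‖ ^ 2 / B g g ≤ s ^ (θ - 2) := by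
    have := (tendsto_rpow_atTop (y := θ - 2) (by linarith [h.two_lt])).eventually_ge_atTop
      (‖g‖ ^ 2 / B g g)
    obtain ⟨s, h1, h2⟩ := (this.and (eventually_gt_atTop 1)).exists
    exact ⟨s, h2, h1⟩
  have hs0 : 0 < s := by linarith
  have hsg : s • g ≠ 0 := smul_ne_zero hs0.ne' hg
  have hle : ‖s • g‖ ^ 2 ≤ B (s • g) (s • g) := by
    rw [h.smul_right, norm_smul, Real.norm_of_nonneg hs0.le]
    have h1 := h.le_deriv_ray hg hs1
    rw [div_le_iff₀ hB] at hs
    have h2 : s ^ (θ - 1) = s * s ^ (θ - 2) := by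
      rw [show θ - 1 = 1 + (θ - 2) by ring, Real.rpow_add hs0, Real.rpow_one]
    rw [h2] at h1
    calc (s * ‖g‖) ^ 2 = s * (s * ‖g‖ ^ 2) := by ring
      _ ≤ s * (s * (s ^ (θ - 2) * B g g)) := by gcongr
      _ ≤ s * B (s • g) g := by gcongr; linarith
  obtain ⟨r, hr, -, hr2⟩ := h.exists_ray_mem hsg hle
  exact ⟨r • s • g, smul_ne_zero hr.ne' hsg, hr2⟩

/-- On the Nehari set, the action is maximal along rays. -/
lemma action_smul_le {w : H} (hw : w ≠ 0) (hN : ‖w‖ ^ 2 = B w w) {s : ℝ} (hs : 0 < s) :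
    action Ψ (s • w) ≤ action Ψ w := by
  have hd : ∀ r : ℝ, HasDerivAt (fun r : ℝ => action Ψ (r • w))
      (r * ‖w‖ ^ 2 - B (r • w) w) r := fun r => by
    have := h.hasDerivAt_action 0 w r
    simp only [zero_add, real_inner_smul_left, real_inner_self_eq_norm_sq] at this
    exact this
  have hc : Continuous (fun r : ℝ => action Ψ (r • w)) :=
    continuous_iff_continuousAt.2 fun r => (hd r).continuousAt
  rcases le_total s 1 with h1 | h1
  · have : MonotoneOn (fun r : ℝ => action Ψ (r • w)) (Icc s 1) := by
      refine monotoneOn_of_deriv_nonneg (convex_Icc _ _) hc.continuousOn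
        (fun r _ => (hd r).differentiableAt.differentiableWithinAt) fun r hr => ?_
      rw [interior_Icc] at hr
      rw [(hd r).deriv, hN]
      linarith [h.deriv_ray_lt hw (hs.trans hr.1) hr.2]
    simpa using this (left_mem_Icc.2 h1) (right_mem_Icc.2 h1) h1
  · have : AntitoneOn (fun r : ℝ => action Ψ (r • w)) (Icc 1 s) := by
      refine antitoneOn_of_deriv_nonpos (convex_Icc _ _) hc.continuousOn
        (fun r _ => (hd r).differentiableAt.differentiableWithinAt) fun r hr => ?_
      rw [interior_Icc] at hr
      rw [(hd r).deriv, hN]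
      linarith [h.lt_deriv_ray hw hr.1]
    simpa using this (left_mem_Icc.2 h1) (right_mem_Icc.2 h1) h1

/-- Coercivity on the Nehari set: `θ * Ψ w ≤ B w w = ‖w‖ ^ 2`, and `θ > 2` makes the constant
positive. -/
lemma norm_sq_le_action {w : H} (hN : ‖w‖ ^ 2 = B w w) :
    (1 / 2 - 1 / θ) * ‖w‖ ^ 2 ≤ action Ψ w := by
  have h0 : 0 < θ := by linarith [h.two_lt]
  have h1 : Ψ w ≤ 1 / θ * ‖w‖ ^ 2 := by
    rw [hN, one_div, inv_mul_eq_div, le_div_iff₀ h0, mul_comm]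
    exact h.le_deriv w
  rw [action]
  linarith

/-- The weak limit of a minimizing sequence may lie off the Nehari set, but only with `‖u‖ ^ 2 ≤ B u
u`, so it can be shrunk onto it. Maximality along rays keeps the shrunken sequence below the infimum
level in the limit. -/
lemma exists_minimizer [CompleteSpace H] [TopologicalSpace.SeparableSpace H] [Nontrivial H] :
    ∃ u : H, u ≠ 0 ∧ ‖u‖ ^ 2 = B u u ∧
      ∀ w : H, w ≠ 0 → ‖w‖ ^ 2 = B w w → action Ψ u ≤ action Ψ w := by
  have hθ := h.two_lt
  set N : Set H := {w | w ≠ 0 ∧ ‖w‖ ^ 2 = B w w} with hNdef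
  have hne : N.Nonempty := h.exists_mem_nehari
  have hκ : 0 < 1 / 2 - 1 / θ := by
    rw [sub_pos]; exact one_div_lt_one_div_of_lt (by norm_num) hθ
  have hbdd : BddBelow (action Ψ '' N) := ⟨0, by
    rintro _ ⟨w, hw, rfl⟩
    exact le_trans (by positivity) (h.norm_sq_le_action hw.2)⟩
  set c := sInf (action Ψ '' N) with hc
  obtain ⟨y, -, hy, hyN⟩ := exists_seq_tendsto_sInf (hne.image (action Ψ)) hbdd
  choose w hwN hwy using hyN
  have hlim : Tendsto (fun k => action Ψ (w k)) atTop (𝓝 c) := by simpa only [hwy] using hy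
  obtain ⟨M, hM⟩ := hlim.bddAbove_range
  have hbound : ∀ k, ‖w k‖ ≤ √(M / (1 / 2 - 1 / θ)) := fun k => by
    refine Real.le_sqrt_of_sq_le ?_
    rw [le_div_iff₀ hκ, mul_comm]
    exact (h.norm_sq_le_action (hwN k).2).trans (hM ⟨k, rfl⟩)
  obtain ⟨u, m, hm, hweak⟩ := exists_weakTendsto_subseq hbound
  obtain ⟨δ, hδ, hsm⟩ := h.small (1 / 2) (by norm_num)
  -- A Nehari vector with `‖w‖ < δ` would satisfy `‖w‖ ^ 2 = B w w ≤ ‖w‖ ^ 2 / 2`.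
  have hlow : ∀ k, δ ^ 2 ≤ ‖w k‖ ^ 2 := fun k => by
    by_contra! hlt
    have h1 : ‖w k‖ < δ := lt_of_pow_lt_pow_left₀ 2 hδ.le hlt
    have h2 := hsm _ h1
    have h3 : 0 < ‖w k‖ := norm_pos_iff.2 (hwN k).1
    rw [← (hwN k).2] at h2
    nlinarith
  have hB : Tendsto (fun k => ‖w (m k)‖ ^ 2) atTop (𝓝 (B u u)) := by
    simpa only [← (hwN _).2] using h.weak_cont_deriv hweak hweak
  have hBpos : δ ^ 2 ≤ B u u := ge_of_tendsto' hB fun k => hlow _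
  have hu : u ≠ 0 := by
    rintro rfl
    have := hsm 0 (by simpa using hδ)
    simp only [norm_zero] at this
    nlinarith
  -- Pass to the limit in Cauchy–Schwarz for `w (m k)` and `u`, using that the squared norms tend to
  -- `B u u`.
  have hle : ‖u‖ ^ 2 ≤ B u u := by
    have h1 : ‖u‖ ^ 2 ≤ √(B u u) * ‖u‖ := by
      rw [← real_inner_self_eq_norm_sq]
      have h2 : Tendsto (fun k => ‖w (m k)‖ * ‖u‖) atTop (𝓝 (√(B u u) * ‖u‖)) := by
        have := (hB.sqrt).mul_const ‖u‖
        simpa only [Real.sqrt_sq (norm_nonneg _)] using this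
      exact le_of_tendsto_of_tendsto' (hweak u) h2 fun k => real_inner_le_norm _ _
    have h3 : 0 < ‖u‖ := norm_pos_iff.2 hu
    have h4 : ‖u‖ ≤ √(B u u) := by
      rw [sq] at h1
      exact le_of_mul_le_mul_right h1 h3
    calc ‖u‖ ^ 2 ≤ √(B u u) ^ 2 := by gcongr
      _ = B u u := Real.sq_sqrt (h.deriv_nonneg u)
  obtain ⟨s, hs, -, hsN⟩ := h.exists_ray_mem hu hle
  have hsu : s • u ≠ 0 := smul_ne_zero hs.ne' hu
  refine ⟨s • u, hsu, hsN, fun v hv hvN => ?_⟩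
  have hcv : c ≤ action Ψ v := csInf_le hbdd ⟨v, ⟨hv, hvN⟩, rfl⟩
  refine le_trans ?_ hcv
  -- The norms of the sequence converge to `√(B u u)`, not necessarily to `‖u‖`; the difference has
  -- the favourable sign by `hle`.
  have hA : Tendsto (fun k => action Ψ (s • w (m k))) atTop
      (𝓝 (1 / 2 * (s ^ 2 * B u u) - Ψ (s • u))) := by
    have h1 := ((hB.const_mul (s ^ 2)).const_mul (1 / 2)).sub (h.weak_cont (hweak.const_smul s))
    refine h1.congr fun k => ?_
    rw [action, norm_smul, Real.norm_of_nonneg hs.le]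
    ring
  have h2 : 1 / 2 * (s ^ 2 * B u u) - Ψ (s • u) ≤ c :=
    le_of_tendsto_of_tendsto' hA (hlim.comp hm.tendsto_atTop) fun k =>
      h.action_smul_le (hwN _).1 (hwN _).2 hs
  refine le_trans ?_ h2
  rw [action, norm_smul, Real.norm_of_nonneg hs.le, mul_pow]
  gcongr

/-- If the action decreases at `u` in the direction `v`, it does so near `u` as well. A small step
`ε • v` followed by rescaling with `s` close to `1` reaches a Nehari point of action below `action Ψ
(s • u) ≤ action Ψ u`. -/
lemma critical_of_minimizer {u : H} (hu : u ≠ 0) (hN : ‖u‖ ^ 2 = B u u)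
    (hmin : ∀ w : H, w ≠ 0 → ‖w‖ ^ 2 = B w w → action Ψ u ≤ action Ψ w) (v : H) :
    B u v ≤ inner ℝ u v := by
  by_contra! hlt
  have hBc := h.continuous_deriv
  have hΦ : Continuous fun p : ℝ × ℝ =>
      inner ℝ (p.1 • (u + p.2 • v)) v - B (p.1 • (u + p.2 • v)) v := by
    refine Continuous.sub (by fun_prop) ?_
    exact hBc.comp (f := fun p : ℝ × ℝ => (p.1 • (u + p.2 • v), v)) (by fun_prop)
  -- The directional derivative stays negative for all scalings near `1` and all steps near `0`.
  have hΦ0 : ∀ᶠ p : ℝ × ℝ in 𝓝 (1, 0),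
      inner ℝ (p.1 • (u + p.2 • v)) v - B (p.1 • (u + p.2 • v)) v < 0 := by
    refine (hΦ.tendsto (1, 0)).eventually_lt_const ?_
    simpa using hlt
  obtain ⟨δ₀, hδ₀, hΦδ⟩ := Metric.eventually_nhds_iff.1 hΦ0
  set δ := min (δ₀ / 2) (1 / 2)
  have hδ : 0 < δ := by positivity
  have hδ1 : δ < 1 := lt_of_le_of_lt (min_le_right _ _) (by norm_num)
  have hδδ : δ < δ₀ := lt_of_le_of_lt (min_le_left _ _) (by linarith)
  have hk : ∀ s : ℝ, Continuous fun ε : ℝ =>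
      s * ‖u + ε • v‖ ^ 2 - B (s • (u + ε • v)) (u + ε • v) := fun s => by
    refine Continuous.sub (by fun_prop) ?_
    exact hBc.comp (f := fun ε : ℝ => (s • (u + ε • v), u + ε • v)) (by fun_prop)
  -- At `ε = 0` the ray function is positive at `1 - δ` and negative at `1 + δ`; both signs persist
  -- for small `ε`, which places a Nehari point on the perturbed ray between these scalings.
  have hk1 : ∀ᶠ ε : ℝ in 𝓝 0,
      0 < (1 - δ) * ‖u + ε • v‖ ^ 2 - B ((1 - δ) • (u + ε • v)) (u + ε • v) := by
    refine ((hk (1 - δ)).tendsto 0).eventually_const_lt ?_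
    simp only [zero_smul, add_zero]
    rw [hN]
    linarith [h.deriv_ray_lt hu (s := 1 - δ) (by linarith) (by linarith)]
  have hk2 : ∀ᶠ ε : ℝ in 𝓝 0,
      (1 + δ) * ‖u + ε • v‖ ^ 2 - B ((1 + δ) • (u + ε • v)) (u + ε • v) < 0 := by
    refine ((hk (1 + δ)).tendsto 0).eventually_lt_const ?_
    simp only [zero_smul, add_zero]
    rw [hN]
    linarith [h.lt_deriv_ray hu (s := 1 + δ) (by linarith)]
  obtain ⟨ε, ⟨⟨hε1, hε2⟩, hεδ⟩, hε⟩ :=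
    (((hk1.and hk2).filter_mono nhdsWithin_le_nhds).and
      ((eventually_lt_nhds hδ).filter_mono nhdsWithin_le_nhds)
      |>.and (self_mem_nhdsWithin (s := Ioi (0 : ℝ)))).exists
  set w := u + ε • v with hw
  have hw0 : w ≠ 0 := by
    intro h0
    rw [h0] at hε1
    have := h.smul_right ((1 - δ) • (0 : H)) 0 0
    simp only [smul_zero, zero_mul] at this
    simp [this] at hε1
  have hcont : ContinuousOn (fun s : ℝ => s * ‖w‖ ^ 2 - B (s • w) w) (Icc (1 - δ) (1 + δ)) :=
    (Continuous.sub (by fun_prop) (h.continuous_ray w)).continuousOn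
  obtain ⟨s, hs, hs0⟩ := intermediate_value_Icc' (by linarith) hcont ⟨hε2.le, hε1.le⟩
  simp only at hs0
  have hspos : 0 < s := by linarith [hs.1]
  have hwN : ‖s • w‖ ^ 2 = B (s • w) (s • w) := by
    rw [h.smul_right, norm_smul, Real.norm_of_nonneg hspos.le,
      show B (s • w) w = s * ‖w‖ ^ 2 by linarith]
    ring
  have h1 := hmin _ (smul_ne_zero hspos.ne' hw0) hwN
  have h2 := h.action_smul_le hu hN hspos
  have hd : ∀ r : ℝ, HasDerivAt (fun r : ℝ => action Ψ (s • (u + r • v)))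
      (s * (inner ℝ (s • (u + r • v)) v - B (s • (u + r • v)) v)) r := fun r => by
    have := h.hasDerivAt_action (s • u) (s • v) r
    have e : ∀ r : ℝ, s • u + r • s • v = s • (u + r • v) := fun r => by
      rw [smul_add, smul_comm]
    simp only [e, h.smul_right, real_inner_smul_right, ← mul_sub] at this
    exact this
  -- Compare along the segment from `s • u` to `s • (u + ε • v)`, which lies in the region where the
  -- derivative is negative.
  have hanti : StrictAntiOn (fun r : ℝ => action Ψ (s • (u + r • v))) (Icc 0 ε) := by
    refine strictAntiOn_of_deriv_neg (convex_Icc _ _)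
      (continuous_iff_continuousAt.2 fun r => (hd r).continuousAt).continuousOn fun r hr => ?_
    rw [interior_Icc] at hr
    rw [(hd r).deriv]
    refine mul_neg_of_pos_of_neg hspos (@hΦδ (s, r) ?_)
    rw [Prod.dist_eq, max_lt_iff, Real.dist_eq, Real.dist_eq, abs_lt, abs_lt]
    simp only [sub_zero]
    refine ⟨⟨by linarith [hs.1], by linarith [hs.2]⟩, by linarith [hr.1], by linarith [hr.2]⟩
  have h3 := hanti (left_mem_Icc.2 hε.le) (right_mem_Icc.2 hε.le) hε
  simp only [zero_smul, add_zero] at h3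
  linarith

/-- Existence of a critical point minimizing the action on the Nehari set. -/
theorem exists_groundState [CompleteSpace H] [TopologicalSpace.SeparableSpace H] [Nontrivial H] :
    ∃ u : H, u ≠ 0 ∧ (∀ v, inner ℝ u v = B u v) ∧
      ∀ w : H, w ≠ 0 → ‖w‖ ^ 2 = B w w → action Ψ u ≤ action Ψ w := by
  obtain ⟨u, hu, hN, hmin⟩ := h.exists_minimizer
  refine ⟨u, hu, fun v => le_antisymm ?_ (h.critical_of_minimizer hu hN hmin v), hmin⟩
  -- The opposite direction `-v` gives the reverse inequality.
  have h1 := h.critical_of_minimizer hu hN hmin (-v)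
  have h2 := h.smul_right u (-1) v
  rw [neg_one_smul] at h2
  rw [h2, inner_neg_right] at h1
  linarith

end Superquadratic

end Nehari

/-! ### Power kernels and Fubini estimates -/

section Kernel

instance isFiniteMeasure_vol (L : ℝ) : IsFiniteMeasure (vol L) := by
  unfold vol; infer_instance

lemma integral_vol {E : Type*} [NormedAddCommGroup E] [NormedSpace ℝ E] {T : ℝ} (hT : 0 ≤ T)
    (f : ℝ → E) : ∫ s, f s ∂vol T = ∫ s in (0 : ℝ)..T, f s := by
  rw [intervalIntegral.integral_of_le hT, integral_Ioc_eq_integral_Ioo, vol]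

lemma integrable_vol_iff {E : Type*} [NormedAddCommGroup E] {T : ℝ} (hT : 0 ≤ T) {f : ℝ → E} :
    Integrable f (vol T) ↔ IntervalIntegrable f volume 0 T := by
  rw [intervalIntegrable_iff_integrableOn_Ioo_of_le hT, IntegrableOn, vol]

lemma ae_vol_mem (T : ℝ) : ∀ᵐ s ∂vol T, s ∈ Ioo 0 T := ae_restrict_mem measurableSet_Ioo

lemma vol_mono {t T : ℝ} (h : t ≤ T) : vol t ≤ vol T :=
  Measure.restrict_mono (Ioo_subset_Ioo_right h) le_rfl

/-- The power kernel of order `β`, extended by zero. -/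
noncomputable def ker (β x : ℝ) : ℝ := (Ioi (0 : ℝ)).indicator (fun x => x ^ (β - 1)) x

lemma ker_of_pos {β x : ℝ} (hx : 0 < x) : ker β x = x ^ (β - 1) := indicator_of_mem hx _

lemma ker_of_nonpos {β x : ℝ} (hx : x ≤ 0) : ker β x = 0 :=
  indicator_of_notMem (by simpa using hx) _

lemma ker_nonneg (β x : ℝ) : 0 ≤ ker β x :=
  indicator_nonneg (fun _ hx => Real.rpow_nonneg (le_of_lt hx) _) _

@[fun_prop]
lemma measurable_ker (β : ℝ) : Measurable (ker β) :=
  Measurable.indicator (by fun_prop) measurableSet_Ioi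

/-- The squared kernel is again a kernel, integrable near `0` when `2 * β - 1 > 0`; this is where `α
> 1/2` enters. -/
lemma ker_sq (β x : ℝ) : ker β x ^ 2 = ker (2 * β - 1) x := by
  rcases lt_or_ge 0 x with hx | hx
  · rw [ker_of_pos hx, ker_of_pos hx, ← Real.rpow_natCast, ← Real.rpow_mul hx.le]
    congr 1; push_cast; ring
  · simp [ker_of_nonpos hx]

/-- Moves the dependence on `t` from the domain to the kernel, so that Fubini applies with one fixed
measure. -/
lemma integral_ker_smul_left {E : Type*} [NormedAddCommGroup E] [NormedSpace ℝ E]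
    (β : ℝ) (u : ℝ → E) {t T : ℝ} (ht : 0 ≤ t) (hT : t ≤ T) :
    ∫ s, ker β (t - s) • u s ∂vol T = ∫ s in (0 : ℝ)..t, (t - s) ^ (β - 1) • u s := by
  rw [intervalIntegral.integral_of_le ht, integral_Ioc_eq_integral_Ioo, vol,
    setIntegral_eq_of_subset_of_forall_sdiff_eq_zero (f := fun s => ker β (t - s) • u s)
      measurableSet_Ioo (Ioo_subset_Ioo_right hT)]
  · exact setIntegral_congr_fun measurableSet_Ioo fun s hs => by
      simp only [ker_of_pos (sub_pos.2 hs.2)]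
  · intro s hs
    rw [ker_of_nonpos, zero_smul]
    have := hs.2
    simp only [mem_Ioo, not_and, not_lt] at this
    linarith [this hs.1.1]

lemma integral_ker_smul_right {E : Type*} [NormedAddCommGroup E] [NormedSpace ℝ E]
    (β : ℝ) (u : ℝ → E) {t L : ℝ} (ht : 0 ≤ t) (hL : t ≤ L) :
    ∫ s, ker β (s - t) • u s ∂vol L = ∫ s in t..L, (s - t) ^ (β - 1) • u s := by
  rw [intervalIntegral.integral_of_le hL, integral_Ioc_eq_integral_Ioo, vol,
    setIntegral_eq_of_subset_of_forall_sdiff_eq_zero (f := fun s => ker β (s - t) • u s)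
      measurableSet_Ioo (Ioo_subset_Ioo_left ht)]
  · exact setIntegral_congr_fun measurableSet_Ioo fun s hs => by
      simp only [ker_of_pos (sub_pos.2 hs.1)]
  · intro s hs
    rw [ker_of_nonpos, zero_smul]
    have := hs.2
    simp only [mem_Ioo, not_and, not_lt] at this
    by_contra! h
    linarith [this (by linarith), hs.1.2]

lemma integrable_ker_left {β : ℝ} (hβ : 0 < β) (t T : ℝ) (hT : 0 ≤ T) :
    Integrable (fun s => ker β (t - s)) (vol T) := by
  have h1 : IntervalIntegrable (fun s : ℝ => s ^ (β - 1)) volume (t - 0) (t - T) :=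
    intervalIntegral.intervalIntegrable_rpow' (by linarith)
  have h2 := (h1.comp_sub_left t)
  simp only [sub_zero, sub_sub_cancel, sub_self] at h2
  rw [← integrable_vol_iff hT] at h2
  refine h2.mono (Measurable.aestronglyMeasurable (by fun_prop)) (Eventually.of_forall fun s => ?_)
  rcases lt_or_ge 0 (t - s) with hx | hx
  · rw [ker_of_pos hx]
  · rw [ker_of_nonpos hx]; simp

lemma integrable_ker_right {β : ℝ} (hβ : 0 < β) (t T : ℝ) (hT : 0 ≤ T) :
    Integrable (fun s => ker β (s - t)) (vol T) := by
  have h1 : IntervalIntegrable (fun s : ℝ => s ^ (β - 1)) volume (0 - t) (T - t) :=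
    intervalIntegral.intervalIntegrable_rpow' (by linarith)
  have h2 := (h1.comp_sub_right t)
  simp only [sub_add_cancel] at h2
  rw [← integrable_vol_iff hT] at h2
  refine h2.mono (Measurable.aestronglyMeasurable (by fun_prop)) (Eventually.of_forall fun s => ?_)
  rcases lt_or_ge 0 (s - t) with hx | hx
  · rw [ker_of_pos hx]
  · rw [ker_of_nonpos hx]; simp

lemma integral_ker_left {β : ℝ} (hβ : 0 < β) {t T : ℝ} (ht : 0 ≤ t) (hT : t ≤ T) :
    ∫ s, ker β (t - s) ∂vol T = t ^ β / β := by
  have h := integral_ker_smul_left β (fun _ => (1 : ℝ)) ht hT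
  simp only [smul_eq_mul, mul_one] at h
  rw [h, intervalIntegral.integral_comp_sub_left (fun x => x ^ (β - 1)), sub_self, sub_zero,
    integral_rpow (Or.inl (by linarith)), sub_add_cancel, Real.zero_rpow hβ.ne', sub_zero]

lemma integral_ker_right {β : ℝ} (hβ : 0 < β) {t T : ℝ} (ht : 0 ≤ t) (hT : t ≤ T) :
    ∫ s, ker β (s - t) ∂vol T = (T - t) ^ β / β := by
  have h := integral_ker_smul_right β (fun _ => (1 : ℝ)) ht hT
  simp only [smul_eq_mul, mul_one] at h
  rw [h, intervalIntegral.integral_comp_sub_right (fun x => x ^ (β - 1)), sub_self,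
    integral_rpow (Or.inl (by linarith)), sub_add_cancel, Real.zero_rpow hβ.ne', sub_zero]

/-- Euler's beta integral on `(0, d)` for exponents adding up to one. -/
lemma integral_rpow_mul_rpow {a b d : ℝ} (ha : 0 < a) (hb : 0 < b) (hab : a + b = 1)
    (hd : 0 < d) :
    ∫ x in (0 : ℝ)..d, (d - x) ^ (a - 1) * x ^ (b - 1) = Real.Gamma a * Real.Gamma b := by
  have h1 := Complex.betaIntegral_scaled (b : ℂ) (a : ℂ) hd
  have hba : ((b : ℂ) + a - 1) = 0 := by
    rw [sub_eq_zero]; exact_mod_cast (add_comm b a).trans hab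
  rw [hba, Complex.cpow_zero, one_mul] at h1
  have h2 := Complex.Gamma_mul_Gamma_eq_betaIntegral (s := (b : ℂ)) (t := (a : ℂ))
    (by simpa using hb) (by simpa using ha)
  have hba' : ((b : ℂ) + a) = 1 := by exact_mod_cast (add_comm b a).trans hab
  rw [hba', Complex.Gamma_one, one_mul, ← h1, Complex.Gamma_ofReal, Complex.Gamma_ofReal] at h2
  have h3 : (((∫ x in (0 : ℝ)..d, (d - x) ^ (a - 1) * x ^ (b - 1)) : ℝ) : ℂ) =
      ((Real.Gamma a * Real.Gamma b : ℝ) : ℂ) := by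
    rw [← intervalIntegral.integral_ofReal]
    push_cast
    rw [mul_comm, h2]
    refine intervalIntegral.integral_congr fun x hx => ?_
    rw [uIcc_of_le hd.le] at hx
    rw [Complex.ofReal_cpow (sub_nonneg.2 hx.2), Complex.ofReal_cpow hx.1]
    push_cast
    ring
  exact_mod_cast h3

lemma integral_ker_mul_ker {a b : ℝ} (ha : 0 < a) (hb : 0 < b) (hab : a + b = 1)
    {s t : ℝ} (hs : 0 ≤ s) (hst : s < t) :
    ∫ r, ker a (t - r) * ker b (r - s) ∂vol t = Real.Gamma a * Real.Gamma b := by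
  have h := integral_ker_smul_right b (fun r => ker a (t - r)) hs hst.le
  simp only [smul_eq_mul] at h
  simp_rw [mul_comm (ker a _)]
  rw [h, ← integral_rpow_mul_rpow ha hb hab (sub_pos.2 hst),
    ← sub_self s, ← intervalIntegral.integral_comp_sub_right
      (fun x => (t - s - x) ^ (a - 1) * x ^ (b - 1)),
    intervalIntegral.integral_of_le hst.le, intervalIntegral.integral_of_le hst.le,
    integral_Ioc_eq_integral_Ioo, integral_Ioc_eq_integral_Ioo]
  refine setIntegral_congr_fun measurableSet_Ioo fun r hr => ?_
  simp only [ker_of_pos (sub_pos.2 hr.2), sub_sub_sub_cancel_right]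
  ring

/-- A nonintegrable function would have integral `0` by convention, but the beta integral is
positive. -/
lemma integrable_ker_mul_ker {a b : ℝ} (ha : 0 < a) (hb : 0 < b) (hab : a + b = 1)
    {s t : ℝ} (hs : 0 ≤ s) (hst : s < t) :
    Integrable (fun r => ker a (t - r) * ker b (r - s)) (vol t) := by
  by_contra h
  have h1 := integral_ker_mul_ker ha hb hab hs hst
  rw [integral_undef h] at h1
  exact (mul_pos (Real.Gamma_pos_of_pos ha) (Real.Gamma_pos_of_pos hb)).ne h1

/-- Absolute integrability on the square of a weighted convolution integrand. -/
lemma integrable_prod_ker {b T C : ℝ} {w G : ℝ → ℝ} (hw : AEStronglyMeasurable w (vol T))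
    (hw0 : ∀ᵐ r ∂vol T, 0 ≤ w r)
    (hG : Integrable G (vol T))
    (hint : ∀ s ∈ Ioo 0 T, Integrable (fun r => w r * ker b (r - s)) (vol T))
    (hC : ∀ s ∈ Ioo 0 T, ∫ r, w r * ker b (r - s) ∂vol T ≤ C) :
    Integrable (fun p : ℝ × ℝ => w p.1 * ker b (p.1 - p.2) * G p.2) ((vol T).prod (vol T)) := by
  have hm : AEStronglyMeasurable (fun p : ℝ × ℝ => w p.1 * ker b (p.1 - p.2) * G p.2)
      ((vol T).prod (vol T)) := by
    refine (hw.comp_fst.mul ?_).mul hG.aestronglyMeasurable.comp_snd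
    exact ((measurable_ker b).comp (measurable_fst.sub measurable_snd)).aestronglyMeasurable
  -- Tonelli with the kernel variable `r` innermost, where the bound `C` is uniform in `s`.
  rw [integrable_prod_iff' hm]
  constructor
  · filter_upwards [ae_vol_mem T] with s hs
    exact (hint s hs).mul_const _
  · refine (hG.norm.const_mul C).mono hm.prod_swap.norm.integral_prod_right' ?_
    filter_upwards [ae_vol_mem T] with s hs
    have e : ∫ r, ‖w r * ker b (r - s) * G s‖ ∂vol T =
        (∫ r, w r * ker b (r - s) ∂vol T) * ‖G s‖ := by
      rw [← integral_mul_const]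
      refine integral_congr_ae ?_
      filter_upwards [hw0] with r hr
      rw [norm_mul, Real.norm_of_nonneg (mul_nonneg hr (ker_nonneg _ _))]
    have h0 : 0 ≤ ∫ r, w r * ker b (r - s) ∂vol T :=
      integral_nonneg_of_ae (by
        filter_upwards [hw0] with r hr using mul_nonneg hr (ker_nonneg _ _))
    rw [e, Real.norm_of_nonneg (by positivity), norm_mul, norm_norm]
    gcongr
    exact (hC s hs).trans (le_abs_self C)

lemma integrable_prod_ker_of_bounded {b T M : ℝ} (hT : 0 ≤ T) (hb : 0 < b) {w G : ℝ → ℝ}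
    (hw : AEStronglyMeasurable w (vol T)) (hw0 : ∀ᵐ r ∂vol T, 0 ≤ w r)
    (hM : ∀ᵐ r ∂vol T, w r ≤ M) (hG : Integrable G (vol T)) :
    Integrable (fun p : ℝ × ℝ => w p.1 * ker b (p.1 - p.2) * G p.2) ((vol T).prod (vol T)) := by
  have hint : ∀ s ∈ Ioo 0 T, Integrable (fun r => w r * ker b (r - s)) (vol T) := fun s _ => by
    refine (integrable_ker_right hb s T hT).bdd_mul (c := M) hw ?_
    filter_upwards [hw0, hM] with r h0 h1
    rwa [Real.norm_of_nonneg h0]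
  refine integrable_prod_ker (C := |M| * (T ^ b / b)) hw hw0 hG hint fun s hs => ?_
  have h1 : ∫ r, w r * ker b (r - s) ∂vol T ≤ ∫ r, |M| * ker b (r - s) ∂vol T := by
    refine integral_mono_ae (hint s hs) ((integrable_ker_right hb s T hT).const_mul _) ?_
    filter_upwards [hM] with r hr
    exact mul_le_mul_of_nonneg_right (hr.trans (le_abs_self M)) (ker_nonneg _ _)
  rw [integral_const_mul, integral_ker_right hb hs.1.le hs.2.le] at h1
  refine h1.trans ?_
  gcongr
  · linarith [hs.2]
  · linarith [hs.1]

end Kernel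

/-! ### Composition of fractional integrals and integration by parts -/

section Semigroup

variable {n : ℕ}

lemma leftInt_eq_integral_ker (β : ℝ) (u : ℝ → Vec n) {t T : ℝ} (ht : 0 ≤ t) (hT : t ≤ T) :
    leftInt β u t = (Real.Gamma β)⁻¹ • ∫ s, ker β (t - s) • u s ∂vol T := by
  rw [leftInt, integral_ker_smul_left β u ht hT]

lemma rightInt_eq_integral_ker (β : ℝ) (u : ℝ → Vec n) {t L : ℝ} (ht : 0 ≤ t) (hL : t ≤ L) :
    rightInt β L u t = (Real.Gamma β)⁻¹ • ∫ s, ker β (s - t) • u s ∂vol L := by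
  rw [rightInt, integral_ker_smul_right β u ht hL]

lemma leftInt_congr (β : ℝ) {u v : ℝ → Vec n} {T : ℝ} (h : u =ᵐ[vol T] v) {t : ℝ}
    (ht : 0 ≤ t) (hT : t ≤ T) : leftInt β u t = leftInt β v t := by
  rw [leftInt_eq_integral_ker β u ht hT, leftInt_eq_integral_ker β v ht hT]
  congr 1
  refine integral_congr_ae ?_
  filter_upwards [h] with s hs
  rw [hs]

lemma rightInt_congr (β : ℝ) {u v : ℝ → Vec n} {L : ℝ} (h : u =ᵐ[vol L] v) {t : ℝ}
    (ht : 0 ≤ t) (hT : t ≤ L) : rightInt β L u t = rightInt β L v t := by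
  rw [rightInt_eq_integral_ker β u ht hT, rightInt_eq_integral_ker β v ht hT]
  congr 1
  refine integral_congr_ae ?_
  filter_upwards [h] with s hs
  rw [hs]

/-- The reflection `x ↦ L - x` exchanges the two integrals and transfers results from left to right.
-/
lemma rightInt_eq_leftInt (β L : ℝ) (g : ℝ → Vec n) (t : ℝ) :
    rightInt β L g t = leftInt β (fun x => g (L - x)) (L - t) := by
  rw [rightInt, leftInt]
  have h := intervalIntegral.integral_comp_sub_left (a := 0) (b := L - t)
    (fun x => (x - t) ^ (β - 1) • g x) L
  simp only [sub_zero, sub_sub_cancel] at h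
  rw [← h]
  simp_rw [sub_right_comm]

/-- Fractional integrals of complementary orders compose to the ordinary integral. -/
theorem leftInt_leftInt {a b : ℝ} (ha : 0 < a) (hb : 0 < b) (hab : a + b = 1) {g : ℝ → Vec n}
    {t : ℝ} (ht : 0 ≤ t) (hg : Integrable g (vol t)) :
    leftInt a (leftInt b g) t = ∫ s in (0 : ℝ)..t, g s := by
  have hΓa := (Real.Gamma_pos_of_pos ha).ne'
  have hΓb := (Real.Gamma_pos_of_pos hb).ne'
  -- Absolute integrability for Fubini: the weight `ker a (t - r)` may be unbounded, but its
  -- integral against `ker b (r - s)` equals `Γ(a) Γ(b)` for every `s`, because `a + b = 1`.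
  have hP := integrable_prod_ker (b := b) (w := fun r => ker a (t - r)) (G := fun s => ‖g s‖)
    (T := t) (C := Real.Gamma a * Real.Gamma b)
    (Measurable.aestronglyMeasurable (by fun_prop))
    (Eventually.of_forall fun r => ker_nonneg _ _) hg.norm
    (fun s hs => integrable_ker_mul_ker ha hb hab hs.1.le hs.2)
    (fun s hs => (integral_ker_mul_ker ha hb hab hs.1.le hs.2).le)
  have hF : Integrable (fun p : ℝ × ℝ => (ker a (t - p.1) * ker b (p.1 - p.2)) • g p.2)
      ((vol t).prod (vol t)) := by
    refine hP.mono' ?_ (Eventually.of_forall fun p => ?_)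
    · have hm : AEStronglyMeasurable (fun p : ℝ × ℝ => g p.2) ((vol t).prod (vol t)) :=
        hg.aestronglyMeasurable.comp_snd
      refine AEStronglyMeasurable.smul
        (f := fun p : ℝ × ℝ => ker a (t - p.1) * ker b (p.1 - p.2)) ?_ hm
      exact Measurable.aestronglyMeasurable
        (((measurable_ker a).comp (measurable_const.sub measurable_fst)).mul
        ((measurable_ker b).comp (measurable_fst.sub measurable_snd)))
    · rw [norm_smul, Real.norm_of_nonneg (mul_nonneg (ker_nonneg _ _) (ker_nonneg _ _))]
  have hswap := integral_integral_swap (f := fun r s => (ker a (t - r) * ker b (r - s)) • g s) hF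
  have hL : ∫ r, ∫ s, (ker a (t - r) * ker b (r - s)) • g s ∂vol t ∂vol t =
      Real.Gamma b • ∫ r, ker a (t - r) • leftInt b g r ∂vol t := by
    rw [← integral_smul]
    refine integral_congr_ae ?_
    filter_upwards [ae_vol_mem t] with r hr
    rw [leftInt_eq_integral_ker b g hr.1.le hr.2.le, smul_comm, smul_inv_smul₀ hΓb,
      ← integral_smul]
    simp_rw [mul_smul]
  have hR : ∫ s, ∫ r, (ker a (t - r) * ker b (r - s)) • g s ∂vol t ∂vol t =
      (Real.Gamma a * Real.Gamma b) • ∫ s, g s ∂vol t := by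
    rw [← integral_smul]
    refine integral_congr_ae ?_
    filter_upwards [ae_vol_mem t] with s hs
    rw [integral_smul_const, integral_ker_mul_ker ha hb hab hs.1.le hs.2]
  rw [hL, hR, mul_comm, mul_smul] at hswap
  have h2 := smul_right_injective (Vec n) hΓb hswap
  rw [leftInt_eq_integral_ker a _ ht le_rfl, h2, inv_smul_smul₀ hΓa, integral_vol ht]

theorem rightInt_rightInt {a b L : ℝ} (ha : 0 < a) (hb : 0 < b) (hab : a + b = 1)
    {g : ℝ → Vec n} {t : ℝ} (ht : 0 ≤ t) (htL : t ≤ L) (hg : Integrable g (vol L)) :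
    rightInt a L (rightInt b L g) t = ∫ s in t..L, g s := by
  rw [rightInt_eq_leftInt]
  simp_rw [rightInt_eq_leftInt b, sub_sub_cancel]
  rw [leftInt_leftInt ha hb hab (sub_nonneg.2 htL)]
  · rw [intervalIntegral.integral_comp_sub_left g]; simp
  · have h1 := (integrable_vol_iff (ht.trans htL)).1 hg
    have h2 := h1.comp_sub_left L
    simp only [sub_zero, sub_self] at h2
    exact ((integrable_vol_iff (ht.trans htL)).2 h2.symm).mono_measure (vol_mono (by linarith))

/-- For `g` merely integrable the defining integral need only converge for almost every `r`; Fubini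
on the square supplies this. -/
lemma ae_integrable_ker_smul {b T : ℝ} (hT : 0 ≤ T) (hb : 0 < b) {g : ℝ → Vec n}
    (hg : Integrable g (vol T)) :
    (∀ᵐ r ∂vol T, Integrable (fun s => ker b (r - s) • g s) (vol T)) ∧
      Integrable (leftInt b g) (vol T) := by
  have hP := integrable_prod_ker_of_bounded (w := fun _ => 1) (M := 1) hT hb
    aestronglyMeasurable_const (Eventually.of_forall fun _ => zero_le_one)
    (Eventually.of_forall fun _ => le_rfl) hg.norm
  have hF : Integrable (fun p : ℝ × ℝ => ker b (p.1 - p.2) • g p.2) ((vol T).prod (vol T)) := by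
    refine hP.mono' ?_ (Eventually.of_forall fun p => ?_)
    · have hm : AEStronglyMeasurable (fun p : ℝ × ℝ => g p.2) ((vol T).prod (vol T)) :=
        hg.aestronglyMeasurable.comp_snd
      refine AEStronglyMeasurable.smul (f := fun p : ℝ × ℝ => ker b (p.1 - p.2)) ?_ hm
      exact Measurable.aestronglyMeasurable
        ((measurable_ker b).comp (measurable_fst.sub measurable_snd))
    · rw [norm_smul, Real.norm_of_nonneg (ker_nonneg _ _), one_mul]
  refine ⟨hF.prod_right_ae, ?_⟩
  refine (hF.integral_prod_left.smul (Real.Gamma b)⁻¹).congr ?_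
  filter_upwards [ae_vol_mem T] with r hr
  exact (leftInt_eq_integral_ker b g hr.1.le hr.2.le).symm

lemma integrable_leftInt {b T : ℝ} (hT : 0 ≤ T) (hb : 0 < b) {g : ℝ → Vec n}
    (hg : Integrable g (vol T)) : Integrable (leftInt b g) (vol T) :=
  (ae_integrable_ker_smul hT hb hg).2

lemma integrable_reflect {E : Type*} [NormedAddCommGroup E] {L : ℝ} (hL : 0 ≤ L) {g : ℝ → E}
    (hg : Integrable g (vol L)) : Integrable (fun x => g (L - x)) (vol L) := by
  have h2 := ((integrable_vol_iff hL).1 hg).comp_sub_left L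
  simp only [sub_zero, sub_self] at h2
  exact (integrable_vol_iff hL).2 h2.symm

lemma integrable_rightInt {b L : ℝ} (hL : 0 ≤ L) (hb : 0 < b) {g : ℝ → Vec n}
    (hg : Integrable g (vol L)) : Integrable (rightInt b L g) (vol L) := by
  have h := integrable_reflect hL (integrable_leftInt hL hb (integrable_reflect hL hg))
  refine h.congr (Eventually.of_forall fun t => ?_)
  rw [rightInt_eq_leftInt]

/-- Fractional integration by parts. -/
theorem integral_inner_leftInt {b L M : ℝ} (hL : 0 ≤ L) (hb : 0 < b) {f g : ℝ → Vec n}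
    (hf : AEStronglyMeasurable f (vol L)) (hM : ∀ᵐ t ∂vol L, ‖f t‖ ≤ M)
    (hg : Integrable g (vol L)) :
    ∫ t in (0 : ℝ)..L, inner ℝ (f t) (leftInt b g t) =
      ∫ t in (0 : ℝ)..L, inner ℝ (rightInt b L f t) (g t) := by
  rw [← integral_vol hL, ← integral_vol hL]
  have hP := integrable_prod_ker_of_bounded (w := fun r => ‖f r‖) hL hb
    hf.norm (Eventually.of_forall fun _ => norm_nonneg _) hM hg.norm
  have hF : Integrable (fun p : ℝ × ℝ => ker b (p.1 - p.2) * inner ℝ (f p.1) (g p.2))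
      ((vol L).prod (vol L)) := by
    refine hP.mono' ?_ (Eventually.of_forall fun p => ?_)
    · refine AEStronglyMeasurable.mul ?_
        (hf.comp_fst.inner hg.aestronglyMeasurable.comp_snd)
      exact Measurable.aestronglyMeasurable
        ((measurable_ker b).comp (measurable_fst.sub measurable_snd))
    · rw [norm_mul, Real.norm_of_nonneg (ker_nonneg _ _)]
      calc ker b (p.1 - p.2) * ‖inner ℝ (f p.1) (g p.2)‖
          ≤ ker b (p.1 - p.2) * (‖f p.1‖ * ‖g p.2‖) :=
            mul_le_mul_of_nonneg_left (norm_inner_le_norm _ _) (ker_nonneg _ _)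
        _ = _ := by ring
  have hswap := integral_integral_swap
    (f := fun r s => ker b (r - s) * inner ℝ (f r) (g s)) hF
  have h1 : ∫ t, inner ℝ (f t) (leftInt b g t) ∂vol L = (Real.Gamma b)⁻¹ *
      ∫ r, ∫ s, ker b (r - s) * inner ℝ (f r) (g s) ∂vol L ∂vol L := by
    rw [← integral_const_mul]
    refine integral_congr_ae ?_
    filter_upwards [ae_vol_mem L, (ae_integrable_ker_smul hL hb hg).1] with r hr hi
    rw [leftInt_eq_integral_ker b g hr.1.le hr.2.le, real_inner_smul_right,
      ← integral_inner hi]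
    simp_rw [real_inner_smul_right]
  have h2 : ∫ t, inner ℝ (rightInt b L f t) (g t) ∂vol L = (Real.Gamma b)⁻¹ *
      ∫ s, ∫ r, ker b (r - s) * inner ℝ (f r) (g s) ∂vol L ∂vol L := by
    rw [← integral_const_mul]
    refine integral_congr_ae ?_
    filter_upwards [ae_vol_mem L] with s hs
    have hi : Integrable (fun r => ker b (r - s) • f r) (vol L) :=
      (integrable_ker_right hb s L hL).smul_bdd M hf hM
    rw [rightInt_eq_integral_ker b f hs.1.le hs.2.le, real_inner_smul_left, real_inner_comm,
      ← integral_inner hi]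
    simp_rw [real_inner_smul_right, real_inner_comm]
  rw [h1, h2, hswap]

/-- Fractional integration by parts with the regularity assumptions exchanged. -/
theorem integral_inner_leftInt' {b L M : ℝ} (hL : 0 ≤ L) (hb : 0 < b) {f g : ℝ → Vec n}
    (hf : Integrable f (vol L)) (hg : Integrable g (vol L)) (hM : ∀ t ∈ Ioo 0 L, ‖g t‖ ≤ M) :
    ∫ t in (0 : ℝ)..L, inner ℝ (f t) (leftInt b g t) =
      ∫ t in (0 : ℝ)..L, inner ℝ (rightInt b L f t) (g t) := by
  -- Reflection swaps the roles of the bounded and the integrable factor.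
  have h := integral_inner_leftInt (f := fun x => g (L - x)) (g := fun x => f (L - x)) (M := M)
    hL hb (integrable_reflect hL hg).aestronglyMeasurable (by
      filter_upwards [ae_vol_mem L] with t ht
      exact hM _ ⟨by linarith [ht.2], by linarith [ht.1]⟩) (integrable_reflect hL hf)
  simp_rw [rightInt_eq_leftInt, sub_sub_cancel] at h
  have e1 := intervalIntegral.integral_comp_sub_left (a := 0) (b := L)
    (fun t => inner ℝ (leftInt b g t) (f t)) L
  have e2 := intervalIntegral.integral_comp_sub_left (a := 0) (b := L)
    (fun t => inner ℝ (g t) (rightInt b L f t)) L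
  simp only [sub_zero, sub_self, rightInt_eq_leftInt, sub_sub_cancel] at e1 e2
  rw [e1, e2] at h
  simp_rw [rightInt_eq_leftInt]
  simp_rw [real_inner_comm _ (f _), real_inner_comm (g _)]
  rw [← h]

end Semigroup

/-! ### Continuity of fractional integrals, and test functions -/

section Regularity

variable {n : ℕ}

/-- The substitution `s = t * r` fixes both the domain and the singularity, so continuity in `t`
becomes a matter of dominated convergence. -/
lemma leftInt_eq_rpow_smul {β : ℝ} (hβ : 0 < β) (f : ℝ → Vec n) {t : ℝ} (ht : 0 ≤ t) :
    leftInt β f t = (Real.Gamma β)⁻¹ •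
      t ^ β • ∫ r in (0 : ℝ)..1, (1 - r) ^ (β - 1) • f (t * r) := by
  rcases ht.eq_or_lt with rfl | ht0
  · simp [leftInt, Real.zero_rpow hβ.ne']
  rw [leftInt]
  congr 1
  have h := intervalIntegral.smul_integral_comp_mul_left (a := 0) (b := 1)
    (fun s => (t - s) ^ (β - 1) • f s) t
  simp only [mul_zero, mul_one] at h
  rw [← h, show t ^ β = t * t ^ (β - 1) by
    rw [Real.rpow_sub_one ht0.ne']; field_simp, mul_smul]
  congr 1
  rw [← intervalIntegral.integral_smul]
  refine intervalIntegral.integral_congr fun r hr => ?_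
  rw [uIcc_of_le zero_le_one] at hr
  rw [smul_smul, ← Real.mul_rpow ht (by linarith [hr.2])]
  congr 2
  ring

lemma continuousOn_leftInt {β : ℝ} (hβ : 0 < β) {L : ℝ} (hL : 0 ≤ L) {f : ℝ → Vec n}
    (hf : ContinuousOn f (Icc 0 L)) : ContinuousOn (leftInt β f) (Icc 0 L) := by
  -- Constant extension beyond the endpoints: continuous and bounded on the whole line.
  set F : ℝ → Vec n := IccExtend hL ((Icc 0 L).domRestrict f) with hF
  have hFc : Continuous F := hf.domRestrict.Icc_extend'
  obtain ⟨M, hM⟩ := isCompact_Icc.exists_bound_of_continuousOn hf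
  have hFM : ∀ x, ‖F x‖ ≤ M := fun x => hM _ (projIcc 0 L hL x).2
  have hFf : ∀ x ∈ Icc 0 L, F x = f x := fun x hx => by
    rw [hF, IccExtend_of_mem hL _ hx]; rfl
  have hk : IntervalIntegrable (fun r : ℝ => (1 - r) ^ (β - 1)) volume 0 1 := by
    have h1 : IntervalIntegrable (fun s : ℝ => s ^ (β - 1)) volume 0 1 :=
      intervalIntegral.intervalIntegrable_rpow' (by linarith)
    simpa using (h1.comp_sub_left 1).symm
  have hcont : Continuous fun t : ℝ => ∫ r in (0 : ℝ)..1, (1 - r) ^ (β - 1) • F (t * r) := by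
    refine intervalIntegral.continuous_of_dominated_interval
      (bound := fun r => ‖(1 - r) ^ (β - 1)‖ * M) (fun t => ?_) (fun t => ?_)
      (hk.norm.mul_const M) (Eventually.of_forall fun r _ => by fun_prop)
    · refine AEStronglyMeasurable.smul (f := fun r : ℝ => (1 - r) ^ (β - 1)) ?_ ?_
      · exact Measurable.aestronglyMeasurable (by fun_prop)
      · exact Continuous.aestronglyMeasurable (by fun_prop)
    · refine Eventually.of_forall fun r _ => ?_
      rw [norm_smul]
      exact mul_le_mul_of_nonneg_left (hFM _) (norm_nonneg _)
  have hpow : Continuous fun t : ℝ => t ^ β := Real.continuous_rpow_const hβ.le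
  refine ((hpow.smul hcont).const_smul (Real.Gamma β)⁻¹).continuousOn.congr fun t ht => ?_
  rw [leftInt_eq_rpow_smul hβ f ht.1]
  congr 2
  refine intervalIntegral.integral_congr fun r hr => ?_
  rw [uIcc_of_le zero_le_one] at hr
  rw [hFf]
  exact ⟨mul_nonneg ht.1 hr.1, (mul_le_of_le_one_right ht.1 hr.2).trans ht.2⟩

lemma continuousOn_rightInt {β : ℝ} (hβ : 0 < β) {L : ℝ} (hL : 0 ≤ L) {f : ℝ → Vec n}
    (hf : ContinuousOn f (Icc 0 L)) : ContinuousOn (rightInt β L f) (Icc 0 L) := by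
  have hm : MapsTo (fun x : ℝ => L - x) (Icc 0 L) (Icc 0 L) := fun x hx =>
    ⟨by linarith [hx.2], by linarith [hx.1]⟩
  have hc : ContinuousOn (fun x : ℝ => L - x) (Icc 0 L) := by fun_prop
  have h := (continuousOn_leftInt hβ hL (hf.comp hc hm)).comp hc hm
  refine h.congr fun t _ => ?_
  rw [rightInt_eq_leftInt]; rfl

lemma IsTest.apply_eq_zero {L : ℝ} {φ : ℝ → Vec n} (hφ : IsTest L φ) {t : ℝ}
    (ht : t ∉ Ioo 0 L) : φ t = 0 :=
  image_eq_zero_of_notMem_tsupport fun h => ht (hφ.2.2 h)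

lemma IsTest.deriv {L : ℝ} {φ : ℝ → Vec n} (hφ : IsTest L φ) : IsTest L (deriv φ) :=
  ⟨(contDiff_infty_iff_deriv.1 hφ.1).2, hφ.2.1.deriv,
    (tsupport_deriv_subset (𝕜 := ℝ) (f := φ)).trans hφ.2.2⟩

lemma locallyIntegrable_ker {β : ℝ} (hβ : 0 < β) : LocallyIntegrable (ker β) := by
  rw [locallyIntegrable_iff]
  intro K hK
  obtain ⟨R, hR⟩ := hK.isBounded.subset_closedBall 0
  rw [Real.closedBall_eq_Icc] at hR
  refine IntegrableOn.mono_set ?_ hR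
  rcases le_or_gt 0 R with h0 | h0
  · have h1 : IntervalIntegrable (fun s : ℝ => s ^ (β - 1)) volume (0 - R) (0 + R) :=
      intervalIntegral.intervalIntegrable_rpow' (by linarith)
    rw [intervalIntegrable_iff_integrableOn_Icc_of_le (by linarith)] at h1
    refine Integrable.mono h1 (measurable_ker β).aestronglyMeasurable
      (Eventually.of_forall fun s => ?_)
    rcases lt_or_ge 0 s with hx | hx
    · rw [ker_of_pos hx]
    · rw [ker_of_nonpos hx]; simp
  · rw [Icc_eq_empty (by linarith)]; simp

/-- A test function vanishes off `(0, L)`, so the truncation is invisible and derivatives of the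
convolution fall on `φ`. -/
lemma IsTest.leftInt_eq_convolution {L β : ℝ} {φ : ℝ → Vec n} (hφ : IsTest L φ)
    {t : ℝ} (ht : t ∈ Icc 0 L) :
    leftInt β φ t = (Real.Gamma β)⁻¹ •
      convolution (ker β) φ (ContinuousLinearMap.lsmul ℝ ℝ) volume t := by
  rw [leftInt_eq_integral_ker β φ ht.1 ht.2, convolution_eq_swap, vol]
  congr 1
  simp only [ContinuousLinearMap.lsmul_apply]
  exact setIntegral_eq_integral_of_forall_compl_eq_zero fun s hs => by
    rw [hφ.apply_eq_zero hs, smul_zero]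

lemma IsTest.hasDerivAt_leftInt {L β : ℝ} (hβ : 0 < β) {φ : ℝ → Vec n} (hφ : IsTest L φ)
    {t : ℝ} (ht : t ∈ Ioo 0 L) :
    HasDerivAt (leftInt β φ) (leftInt β (_root_.deriv φ) t) t := by
  have h := hφ.2.1.hasDerivAt_convolution_right (ContinuousLinearMap.lsmul ℝ ℝ)
    (locallyIntegrable_ker hβ) (μ := volume) (hφ.1.of_le (by exact_mod_cast le_top)) t
  have h2 := h.const_smul (Real.Gamma β)⁻¹
  rw [hφ.deriv.leftInt_eq_convolution (Ioo_subset_Icc_self ht)]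
  refine h2.congr_of_eventuallyEq ?_
  filter_upwards [Ioo_mem_nhds ht.1 ht.2] with x hx
  rw [hφ.leftInt_eq_convolution (Ioo_subset_Icc_self hx)]
  rfl

lemma IsTest.leftDeriv_eq {L α : ℝ} (hα : α < 1) {φ : ℝ → Vec n} (hφ : IsTest L φ)
    {t : ℝ} (ht : t ∈ Ioo 0 L) : leftDeriv α φ t = leftInt (1 - α) (_root_.deriv φ) t :=
  (hφ.hasDerivAt_leftInt (by linarith) ht).deriv

lemma IsTest.leftDeriv_ae_eq {L α : ℝ} (hα : α < 1) {φ : ℝ → Vec n} (hφ : IsTest L φ) :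
    leftDeriv α φ =ᵐ[vol L] leftInt (1 - α) (_root_.deriv φ) := by
  filter_upwards [ae_vol_mem L] with t ht using hφ.leftDeriv_eq hα ht

lemma aestronglyMeasurable_vol_of_continuousOn {E : Type*} [NormedAddCommGroup E]
    {L : ℝ} {f : ℝ → E} (hf : ContinuousOn f (Icc 0 L)) : AEStronglyMeasurable f (vol L) :=
  (hf.aestronglyMeasurable measurableSet_Icc).mono_measure
    (Measure.restrict_mono Ioo_subset_Icc_self le_rfl)

lemma memLp_vol_of_continuousOn {E : Type*} [NormedAddCommGroup E] {p : ENNReal}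
    {L : ℝ} {f : ℝ → E} (hf : ContinuousOn f (Icc 0 L)) : MemLp f p (vol L) := by
  obtain ⟨M, hM⟩ := isCompact_Icc.exists_bound_of_continuousOn hf
  refine MemLp.of_bound (aestronglyMeasurable_vol_of_continuousOn hf) M ?_
  filter_upwards [ae_vol_mem L] with t ht using hM t (Ioo_subset_Icc_self ht)

lemma integrable_vol_of_continuousOn {E : Type*} [NormedAddCommGroup E]
    {L : ℝ} {f : ℝ → E} (hf : ContinuousOn f (Icc 0 L)) : Integrable f (vol L) :=
  memLp_one_iff_integrable.1 (memLp_vol_of_continuousOn hf)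

lemma IsTest.memLp_leftDeriv {L α : ℝ} (hL : 0 ≤ L) (hα : α < 1) {φ : ℝ → Vec n}
    (hφ : IsTest L φ) : MemLp (leftDeriv α φ) 2 (vol L) :=
  (memLp_congr_ae (hφ.leftDeriv_ae_eq hα)).2
    (memLp_vol_of_continuousOn
      (continuousOn_leftInt (by linarith) hL hφ.deriv.1.continuous.continuousOn))

/-- The orders `α` and `1 - α` compose to the ordinary integral of `φ'`, and `φ 0 = 0`. -/
lemma IsTest.leftInt_leftDeriv {L α : ℝ} (hα0 : 0 < α) (hα : α < 1)
    {φ : ℝ → Vec n} (hφ : IsTest L φ) {t : ℝ} (ht : t ∈ Icc 0 L) :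
    leftInt α (leftDeriv α φ) t = φ t := by
  rw [leftInt_congr α (hφ.leftDeriv_ae_eq hα) ht.1 ht.2,
    leftInt_leftInt hα0 (by linarith) (by ring) ht.1
      (integrable_vol_of_continuousOn hφ.deriv.1.continuous.continuousOn),
    intervalIntegral.integral_deriv_eq_sub
      (fun x _ => (hφ.1.differentiable (by simp)).differentiableAt)
      (hφ.deriv.1.continuous.intervalIntegrable _ _),
    hφ.apply_eq_zero (t := 0) (by simp), sub_zero]

/-- Norm of the fractional integral of order `α` from `L²` to the bounded functions. -/
noncomputable def supBound (α L : ℝ) : ℝ :=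
  (Real.Gamma α)⁻¹ * √(L ^ (2 * α - 1) / (2 * α - 1))

lemma supBound_nonneg {α : ℝ} (hα : 1 / 2 < α) (L : ℝ) : 0 ≤ supBound α L :=
  mul_nonneg (inv_nonneg.2 (Real.Gamma_pos_of_pos (by linarith)).le) (Real.sqrt_nonneg _)

lemma memLp_ker {α : ℝ} (hα : 1 / 2 < α) {L : ℝ} (hL : 0 ≤ L) (t : ℝ) :
    MemLp (fun s => ker α (t - s)) 2 (vol L) := by
  rw [memLp_two_iff_integrable_sq (Measurable.aestronglyMeasurable (by fun_prop))]
  simp_rw [ker_sq]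
  exact integrable_ker_left (by linarith) t L hL

lemma integrable_ker_smul {α : ℝ} (hα : 1 / 2 < α) {L : ℝ} (hL : 0 ≤ L) (t : ℝ)
    {g : ℝ → Vec n} (hg : MemLp g 2 (vol L)) :
    Integrable (fun s => ker α (t - s) • g s) (vol L) :=
  memLp_one_iff_integrable.1 (hg.smul (memLp_ker hα hL t))

/-- Cauchy–Schwarz, with the `L²` norm of the kernel computed through `ker_sq`. -/
lemma norm_leftInt_le {α : ℝ} (hα : 1 / 2 < α) {L : ℝ} {g : ℝ → Vec n}
    (hg : MemLp g 2 (vol L)) {t : ℝ} (ht : t ∈ Icc 0 L) :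
    ‖leftInt α g t‖ ≤ supBound α L * √(∫ s, ‖g s‖ ^ 2 ∂vol L) := by
  have hL : 0 ≤ L := ht.1.trans ht.2
  have hΓ := Real.Gamma_pos_of_pos (show 0 < α by linarith)
  rw [leftInt_eq_integral_ker α g ht.1 ht.2, norm_smul, norm_inv, Real.norm_of_nonneg hΓ.le,
    supBound, mul_assoc]
  gcongr
  refine (norm_integral_le_integral_norm _).trans ?_
  simp_rw [norm_smul, Real.norm_of_nonneg (ker_nonneg _ _)]
  have hh := integral_mul_le_Lp_mul_Lq_of_nonneg (μ := vol L) Real.HolderConjugate.two_two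
    (f := fun s => ker α (t - s)) (g := fun s => ‖g s‖)
    (Eventually.of_forall fun _ => ker_nonneg _ _)
    (Eventually.of_forall fun _ => norm_nonneg _)
    (by simpa using memLp_ker hα hL t) (by simpa using hg.norm)
  refine hh.trans ?_
  simp only [Real.rpow_two, ← Real.sqrt_eq_rpow, ker_sq]
  rw [integral_ker_left (by linarith) ht.1 ht.2]
  gcongr
  · linarith
  · exact ht.1
  · linarith
  · exact ht.2

end Regularity

/-! ### Identification of `E₀^α` with a closed subspace of `L²` -/

section Space

variable {n : ℕ}

lemma integrable_ker_smul_of_continuous {β : ℝ} (hβ : 0 < β) {L : ℝ} (hL : 0 ≤ L) (t : ℝ)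
    {f : ℝ → Vec n} (hf : ContinuousOn f (Icc 0 L)) :
    Integrable (fun s => ker β (t - s) • f s) (vol L) := by
  obtain ⟨M, hM⟩ := isCompact_Icc.exists_bound_of_continuousOn hf
  refine (integrable_ker_left hβ t L hL).smul_bdd M
    (aestronglyMeasurable_vol_of_continuousOn hf) ?_
  filter_upwards [ae_vol_mem L] with s hs using hM s (Ioo_subset_Icc_self hs)

lemma leftInt_smul (β c : ℝ) (f : ℝ → Vec n) (t : ℝ) :
    leftInt β (fun s => c • f s) t = c • leftInt β f t := by
  simp_rw [leftInt, smul_comm _ c]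
  rw [intervalIntegral.integral_smul, smul_comm]

lemma leftInt_add {β : ℝ} {f g : ℝ → Vec n} {t L : ℝ} (ht : t ∈ Icc 0 L)
    (hf : Integrable (fun s => ker β (t - s) • f s) (vol L))
    (hg : Integrable (fun s => ker β (t - s) • g s) (vol L)) :
    leftInt β (fun s => f s + g s) t = leftInt β f t + leftInt β g t := by
  simp_rw [leftInt_eq_integral_ker β _ ht.1 ht.2, smul_add]
  rw [integral_add hf hg, smul_add]

lemma leftDeriv_congr (α : ℝ) {u v : ℝ → Vec n} {L : ℝ} (h : u =ᵐ[vol L] v) :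
    ∀ t ∈ Ioo 0 L, leftDeriv α u t = leftDeriv α v t := fun t ht => by
  refine Filter.EventuallyEq.deriv_eq ?_
  filter_upwards [Ioo_mem_nhds ht.1 ht.2] with x hx
  exact leftInt_congr _ h hx.1.le hx.2.le

lemma isTest_zero (L : ℝ) : IsTest L (0 : ℝ → Vec n) :=
  ⟨contDiff_const, HasCompactSupport.zero, by simp [tsupport]⟩

lemma IsTest.add {L : ℝ} {φ ψ : ℝ → Vec n} (hφ : IsTest L φ) (hψ : IsTest L ψ) :
    IsTest L (φ + ψ) :=
  ⟨hφ.1.add hψ.1, hφ.2.1.add hψ.2.1, (tsupport_add φ ψ).trans (union_subset hφ.2.2 hψ.2.2)⟩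

lemma IsTest.const_smul {L : ℝ} {φ : ℝ → Vec n} (hφ : IsTest L φ) (c : ℝ) :
    IsTest L (c • φ) :=
  ⟨hφ.1.const_smul c, hφ.2.1.smul_left (f := fun _ => c),
    (tsupport_smul_subset_right (fun _ => c) φ).trans hφ.2.2⟩

lemma IsTest.leftDeriv_add {L α : ℝ} (hα : α < 1) {φ ψ : ℝ → Vec n} (hφ : IsTest L φ)
    (hψ : IsTest L ψ) {t : ℝ} (ht : t ∈ Ioo 0 L) :
    leftDeriv α (φ + ψ) t = leftDeriv α φ t + leftDeriv α ψ t := by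
  have hL : 0 ≤ L := ht.1.le.trans ht.2.le
  have hβ : 0 < 1 - α := by linarith
  rw [(hφ.add hψ).leftDeriv_eq hα ht, hφ.leftDeriv_eq hα ht, hψ.leftDeriv_eq hα ht,
    ← leftInt_add (Ioo_subset_Icc_self ht)
      (integrable_ker_smul_of_continuous hβ hL t hφ.deriv.1.continuous.continuousOn)
      (integrable_ker_smul_of_continuous hβ hL t hψ.deriv.1.continuous.continuousOn)]
  congr 1
  funext s
  exact deriv_add (hφ.1.differentiable (by simp)).differentiableAt
    (hψ.1.differentiable (by simp)).differentiableAt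

lemma leftDeriv_const_smul (α c : ℝ) (φ : ℝ → Vec n) (t : ℝ) :
    leftDeriv α (c • φ) t = c • leftDeriv α φ t := by
  rw [leftDeriv, show leftInt (1 - α) (c • φ) = c • leftInt (1 - α) φ from
    funext fun t => leftInt_smul _ c φ t, deriv_const_smul_field]
  rfl

/-- Classes in `L²` of the fractional derivatives of test functions. -/
noncomputable def testDerivs (α L : ℝ) (hα : α < 1) : Submodule ℝ (Lp (Vec n) 2 (vol L)) where
  carrier := {g | ∃ φ : ℝ → Vec n, IsTest L φ ∧ g =ᵐ[vol L] leftDeriv α φ}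
  zero_mem' := by
    refine ⟨0, isTest_zero L, ?_⟩
    have h := leftDeriv_const_smul (n := n) α 0 0
    simp only [zero_smul] at h
    filter_upwards [Lp.coeFn_zero (Vec n) 2 (vol L)] with t ht
    rw [ht, h t]; rfl
  add_mem' := by
    rintro f g ⟨φ, hφ, hf⟩ ⟨ψ, hψ, hg⟩
    refine ⟨φ + ψ, hφ.add hψ, ?_⟩
    filter_upwards [hf, hg, Lp.coeFn_add f g, ae_vol_mem L] with t h1 h2 h3 ht
    rw [h3, Pi.add_apply, h1, h2, hφ.leftDeriv_add hα hψ ht]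
  smul_mem' := by
    rintro c f ⟨φ, hφ, hf⟩
    refine ⟨c • φ, hφ.const_smul c, ?_⟩
    filter_upwards [hf, Lp.coeFn_smul c f] with t h1 h2
    rw [h2, Pi.smul_apply, h1, leftDeriv_const_smul]

/-- The Hilbert space of fractional derivatives of elements of `E₀^α`. -/
noncomputable def derivSpace (α L : ℝ) (hα : α < 1) : Submodule ℝ (Lp (Vec n) 2 (vol L)) :=
  (testDerivs α L hα).topologicalClosure

lemma mem_derivSpace_iff {α L : ℝ} {hα : α < 1} {g : Lp (Vec n) 2 (vol L)} :
    g ∈ derivSpace α L hα ↔ ∃ φ : ℕ → ℝ → Vec n, (∀ k, IsTest L (φ k)) ∧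
      Tendsto (fun k => eLpNorm (fun t => leftDeriv α (φ k) t - g t) 2 (vol L)) atTop (𝓝 0) := by
  rw [derivSpace, ← SetLike.mem_coe, Submodule.topologicalClosure_coe, mem_closure_iff_seq_limit]
  constructor
  · rintro ⟨x, hx, hlim⟩
    choose φ hφ hx using hx
    refine ⟨φ, hφ, ?_⟩
    rw [Lp.tendsto_Lp_iff_tendsto_eLpNorm'] at hlim
    refine hlim.congr fun k => eLpNorm_congr_ae ?_
    filter_upwards [hx k] with t ht
    simp [ht]
  · rintro ⟨φ, hφ, hlim⟩
    rcases le_or_gt 0 L with hL | hL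
    · refine ⟨fun k => ((hφ k).memLp_leftDeriv hL hα).toLp _,
        fun k => ⟨φ k, hφ k, MemLp.coeFn_toLp _⟩, ?_⟩
      rw [Lp.tendsto_Lp_iff_tendsto_eLpNorm']
      refine hlim.congr fun k => eLpNorm_congr_ae ?_
      filter_upwards [((hφ k).memLp_leftDeriv hL hα).coeFn_toLp] with t ht
      simp [ht]
    · have hv : vol L = 0 := by simp [vol, Ioo_eq_empty (show ¬ (0 : ℝ) < L by linarith)]
      refine ⟨fun _ => g, fun k => ⟨φ k, hφ k, ?_⟩, tendsto_const_nhds⟩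
      simp [Filter.EventuallyEq, hv]

lemma L2_norm_sq {L : ℝ} (g : Lp (Vec n) 2 (vol L)) : ‖g‖ ^ 2 = ∫ s, ‖g s‖ ^ 2 ∂vol L := by
  rw [← real_inner_self_eq_norm_sq, L2.inner_def]
  simp

/-- Pointwise evaluation of the fractional integral is a bounded operator on `L²`. -/
lemma exists_eval_clm {α : ℝ} (hα : 1 / 2 < α) {L t : ℝ} (ht : t ∈ Icc 0 L) :
    ∃ A : Lp (Vec n) 2 (vol L) →L[ℝ] Vec n, (∀ g, A g = leftInt α g t) ∧
      ∀ g, ‖A g‖ ≤ supBound α L * ‖g‖ := by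
  have hL : 0 ≤ L := ht.1.trans ht.2
  have hbd : ∀ g : Lp (Vec n) 2 (vol L), ‖leftInt α g t‖ ≤ supBound α L * ‖g‖ := fun g => by
    have h := norm_leftInt_le hα (Lp.memLp g) ht
    rwa [← L2_norm_sq, Real.sqrt_sq (norm_nonneg _)] at h
  let A : Lp (Vec n) 2 (vol L) →ₗ[ℝ] Vec n :=
    { toFun := fun g => leftInt α g t
      map_add' := fun f g => by
        rw [leftInt_congr α (Lp.coeFn_add f g) ht.1 ht.2]
        exact leftInt_add ht (integrable_ker_smul hα hL t (Lp.memLp f))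
          (integrable_ker_smul hα hL t (Lp.memLp g))
      map_smul' := fun c g => by
        rw [leftInt_congr α (Lp.coeFn_smul c g) ht.1 ht.2]
        exact leftInt_smul α c g t }
  exact ⟨A.mkContinuous _ hbd, fun g => rfl, hbd⟩

lemma norm_leftInt_sub_le {α : ℝ} (hα : 1 / 2 < α) {L t : ℝ} (ht : t ∈ Icc 0 L)
    {f g : ℝ → Vec n} (hf : MemLp f 2 (vol L)) (hg : MemLp g 2 (vol L)) :
    ‖leftInt α f t - leftInt α g t‖ ≤
      supBound α L * (eLpNorm (fun s => f s - g s) 2 (vol L)).toReal := by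
  obtain ⟨A, hA, hb⟩ := exists_eval_clm (n := n) hα ht
  have h := hb (hf.toLp f - hg.toLp g)
  rw [map_sub, hA, hA, leftInt_congr α hf.coeFn_toLp ht.1 ht.2,
    leftInt_congr α hg.coeFn_toLp ht.1 ht.2, ← MemLp.toLp_sub, Lp.norm_toLp] at h
  exact h

/-- Each `φ k` is the fractional integral of its own derivative, and `leftInt α` is bounded from
`L²` to the sup norm. Continuity and the boundary value at `L` pass to the limit this way. -/
lemma test_tendsto_leftInt {α : ℝ} (hα : 1 / 2 < α) (hα' : α < 1) {L : ℝ} (hL : 0 ≤ L)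
    {φ : ℕ → ℝ → Vec n} (hφ : ∀ k, IsTest L (φ k)) {g : ℝ → Vec n} (hg : MemLp g 2 (vol L))
    (hlim : Tendsto (fun k => eLpNorm (fun t => leftDeriv α (φ k) t - g t) 2 (vol L))
      atTop (𝓝 0)) :
    TendstoUniformlyOn φ (leftInt α g) atTop (Icc 0 L) := by
  have h1 : Tendsto (fun k => supBound α L *
      (eLpNorm (fun t => leftDeriv α (φ k) t - g t) 2 (vol L)).toReal) atTop (𝓝 0) := by
    have := ((ENNReal.tendsto_toReal ENNReal.zero_ne_top).comp hlim).const_mul (supBound α L)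
    simpa using this
  rw [Metric.tendstoUniformlyOn_iff]
  intro ε hε
  filter_upwards [h1.eventually_lt_const hε] with k hk t ht
  rw [dist_comm, dist_eq_norm]
  refine lt_of_le_of_lt ?_ hk
  rw [← (hφ k).leftInt_leftDeriv (by linarith) hα' ht]
  exact norm_leftInt_sub_le hα ht ((hφ k).memLp_leftDeriv hL hα') hg

variable {α L : ℝ} (hα : 1 / 2 < α) {hα' : α < 1} (hL : 0 ≤ L)
include hα hL

lemma continuousOn_leftInt_of_mem {g : Lp (Vec n) 2 (vol L)} (hg : g ∈ derivSpace α L hα') :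
    ContinuousOn (leftInt α g) (Icc 0 L) := by
  obtain ⟨φ, hφ, hlim⟩ := mem_derivSpace_iff.1 hg
  exact (test_tendsto_leftInt hα hα' hL hφ (Lp.memLp g) hlim).continuousOn
    (Frequently.of_forall fun k => (hφ k).1.continuous.continuousOn)

lemma leftInt_right_eq_zero {g : Lp (Vec n) 2 (vol L)} (hg : g ∈ derivSpace α L hα') :
    leftInt α g L = 0 := by
  obtain ⟨φ, hφ, hlim⟩ := mem_derivSpace_iff.1 hg
  have h := (test_tendsto_leftInt hα hα' hL hφ (Lp.memLp g) hlim).tendsto_at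
    (right_mem_Icc.2 hL)
  have h0 : ∀ k, φ k L = 0 := fun k => (hφ k).apply_eq_zero (by simp)
  simp only [h0] at h
  exact tendsto_nhds_unique h tendsto_const_nhds

omit hL in
include hα' in
lemma leftInt_leftInt_Lp (g : Lp (Vec n) 2 (vol L)) {t : ℝ} (ht : t ∈ Icc 0 L) :
    leftInt (1 - α) (leftInt α g) t = ∫ s in (0 : ℝ)..t, g s :=
  leftInt_leftInt (by linarith) (by linarith) (by ring) ht.1
    (((Lp.memLp g).integrable (by norm_num)).mono_measure (vol_mono ht.2))

include hα' in
-- By the composition rule the function to differentiate is `∫₀ᵗ g`, so Lebesgue differentiation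
-- applies; for general `g` this gives only almost every point.
lemma leftDeriv_leftInt_ae_eq (g : Lp (Vec n) 2 (vol L)) :
    leftDeriv α (leftInt α g) =ᵐ[vol L] g := by
  have hg : IntervalIntegrable g volume 0 L :=
    (integrable_vol_iff hL).1 ((Lp.memLp g).integrable (by norm_num))
  have h := ae_restrict_of_ae (s := Ioo 0 L) hg.ae_hasDerivAt_integral
  filter_upwards [h, ae_vol_mem L] with t h1 ht
  have hd := h1 (by rw [uIcc_of_le hL]; exact Ioo_subset_Icc_self ht) 0 left_mem_uIcc
  refine HasDerivAt.deriv (hd.congr_of_eventuallyEq ?_)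
  filter_upwards [Ioo_mem_nhds ht.1 ht.2] with x hx
  exact leftInt_leftInt_Lp hα (hα' := hα') g (Ioo_subset_Icc_self hx)

/-- Fractional integrals of elements of the derivative space belong to `E₀^α`. -/
lemma leftInt_mem_E0 {g : Lp (Vec n) 2 (vol L)} (hg : g ∈ derivSpace α L hα') :
    leftInt α g ∈ E0 α L := by
  have hae := leftDeriv_leftInt_ae_eq hα (hα' := hα') hL g
  have hcont := continuousOn_leftInt_of_mem hα hL hg
  obtain ⟨φ, hφ, hlim⟩ := mem_derivSpace_iff.1 hg
  refine ⟨memLp_vol_of_continuousOn hcont, (memLp_congr_ae hae).2 (Lp.memLp g), φ, hφ, ?_, ?_⟩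
  · have hu := test_tendsto_leftInt hα hα' hL hφ (Lp.memLp g) hlim
    rw [Metric.tendstoUniformlyOn_iff] at hu
    rw [ENNReal.tendsto_nhds_zero]
    intro ε hε
    -- On a finite measure space a uniform bound `δ` gives an `L²` bound `c * δ`.
    set c : ENNReal := vol L univ ^ (2 : ENNReal).toReal⁻¹ with hc
    have hc' : c ≠ ⊤ := by
      rw [hc]; exact ENNReal.rpow_ne_top_of_nonneg (by positivity) (measure_ne_top _ _)
    obtain ⟨δ, hδ, hδε⟩ : ∃ δ : ℝ, 0 < δ ∧ c * ENNReal.ofReal δ ≤ ε := by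
      have h1 : Tendsto (fun δ : ℝ => c * ENNReal.ofReal δ) (𝓝[>] 0) (𝓝 0) := by
        have h2 : Tendsto (fun δ : ℝ => ENNReal.ofReal δ) (𝓝[>] 0) (𝓝 0) := by
          simpa using (ENNReal.continuous_ofReal.tendsto 0).mono_left nhdsWithin_le_nhds
        simpa using ENNReal.Tendsto.const_mul h2 (Or.inr hc')
      obtain ⟨δ, h3, h4⟩ :=
        ((ENNReal.tendsto_nhds_zero.1 h1 ε hε).and self_mem_nhdsWithin).exists
      exact ⟨δ, h4, h3⟩
    filter_upwards [hu δ hδ] with k hk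
    refine (eLpNorm_le_of_ae_bound (C := δ) ?_).trans hδε
    filter_upwards [ae_vol_mem L] with t ht
    rw [← dist_eq_norm, dist_comm]
    exact (hk t (Ioo_subset_Icc_self ht)).le
  · refine hlim.congr fun k => eLpNorm_congr_ae ?_
    filter_upwards [hae] with t ht
    rw [ht]

/-- Every element of `E₀^α` is the fractional integral of its fractional derivative. -/
lemma exists_leftInt_of_mem_E0 {u : ℝ → Vec n} (hu : u ∈ E0 α L) :
    ∃ g ∈ derivSpace (n := n) α L hα', u =ᵐ[vol L] leftInt α g ∧ leftDeriv α u =ᵐ[vol L] g := by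
  obtain ⟨hu2, hd2, φ, hφ, h1, h2⟩ := hu
  have hae := hd2.coeFn_toLp
  have h2' : Tendsto (fun k => eLpNorm (fun t => leftDeriv α (φ k) t - hd2.toLp _ t) 2 (vol L))
      atTop (𝓝 0) := by
    refine h2.congr fun k => eLpNorm_congr_ae ?_
    filter_upwards [hae] with t ht
    rw [ht]
  refine ⟨hd2.toLp _, mem_derivSpace_iff.2 ⟨φ, hφ, h2'⟩, ?_, hae.symm⟩
  have hunif := test_tendsto_leftInt hα hα' hL hφ (Lp.memLp _) h2'
  -- The `L²` limit `u` and the uniform limit `leftInt α g` agree almost everywhere, through an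
  -- almost everywhere convergent subsequence.
  have hmeas : TendstoInMeasure (vol L) φ atTop u :=
    tendstoInMeasure_of_tendsto_eLpNorm (p := 2) (by norm_num)
      (fun k => (hφ k).1.continuous.aestronglyMeasurable) hu2.aestronglyMeasurable h1
  obtain ⟨m, hm, hmae⟩ := hmeas.exists_seq_tendsto_ae
  filter_upwards [hmae, ae_vol_mem L] with t ht htL
  exact tendsto_nhds_unique ht
    ((hunif.tendsto_at (Ioo_subset_Icc_self htL)).comp hm.tendsto_atTop)

include hα' in
-- Injectivity of the identification: nonzero functions correspond to nonzero vectors.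
lemma leftInt_ae_eq_zero_iff (g : Lp (Vec n) 2 (vol L)) :
    leftInt α g =ᵐ[vol L] 0 ↔ g = 0 := by
  constructor
  · intro h
    have h1 := leftDeriv_congr α h
    have h0 := leftDeriv_const_smul (n := n) α 0 0
    simp only [zero_smul] at h0
    rw [Lp.eq_zero_iff_ae_eq_zero]
    filter_upwards [leftDeriv_leftInt_ae_eq hα (hα' := hα') hL g, ae_vol_mem L] with t h2 ht
    rw [← h2, h1 t ht, h0 t]; rfl
  · rintro rfl
    filter_upwards [ae_vol_mem L] with t ht
    rw [leftInt_congr α (Lp.coeFn_zero (Vec n) 2 (vol L)) ht.1.le ht.2.le]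
    simp [leftInt]

end Space

/-! ### Consequences of the conditions on `W` -/

section Potential

variable {n : ℕ} {L θ : ℝ} {W : ℝ → Vec n → ℝ}

namespace Conditions

variable (hW : Conditions L θ W)
include hW

lemma hasFDerivAt {t : ℝ} (ht : t ∈ Icc 0 L) (x : Vec n) :
    HasFDerivAt (W t) ((fderivWithin ℝ (fun p : ℝ × Vec n => W p.1 p.2) (Icc 0 L ×ˢ univ)
      (t, x)).comp (ContinuousLinearMap.inr ℝ ℝ (Vec n))) x := by
  have h1 : HasFDerivWithinAt (fun p : ℝ × Vec n => W p.1 p.2) _ (Icc 0 L ×ˢ univ) (t, x) :=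
    ((hW.contDiff.differentiableOn one_ne_zero) (t, x) ⟨ht, mem_univ _⟩).hasFDerivWithinAt
  have h2 : HasFDerivAt (fun y : Vec n => (t, y)) (ContinuousLinearMap.inr ℝ ℝ (Vec n)) x :=
    hasFDerivAt_prodMk_right t x
  have h3 := h1.comp_hasFDerivAt x h2 (Eventually.of_forall fun y => ⟨ht, mem_univ _⟩)
  exact h3

lemma hasGradientAt {t : ℝ} (ht : t ∈ Icc 0 L) (x : Vec n) :
    HasGradientAt (W t) (∇ (W t) x) x :=
  (hW.hasFDerivAt ht x).differentiableAt.hasGradientAt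

lemma continuousOn_potential :
    ContinuousOn (fun p : ℝ × Vec n => W p.1 p.2) (Icc 0 L ×ˢ univ) :=
  hW.contDiff.continuousOn

lemma continuousOn_gradient (hL : 0 < L) :
    ContinuousOn (fun p : ℝ × Vec n => ∇ (W p.1) p.2) (Icc 0 L ×ˢ univ) := by
  have h := hW.contDiff.continuousOn_fderivWithin
    ((uniqueDiffOn_Icc hL).prod uniqueDiffOn_univ) le_rfl
  have h2 : ContinuousOn (fun p : ℝ × Vec n => (InnerProductSpace.toDual ℝ (Vec n)).symm
      ((fderivWithin ℝ (fun p : ℝ × Vec n => W p.1 p.2) (Icc 0 L ×ˢ univ) p).comp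
        (ContinuousLinearMap.inr ℝ ℝ (Vec n)))) (Icc 0 L ×ˢ univ) :=
    (LinearIsometryEquiv.continuous _).comp_continuousOn (h.clm_comp continuousOn_const)
  refine h2.congr fun p hp => ?_
  rw [gradient, (hW.hasFDerivAt hp.1 p.2).fderiv]

lemma continuousOn_potential_comp {u : ℝ → Vec n} (hu : ContinuousOn u (Icc 0 L)) :
    ContinuousOn (fun t => W t (u t)) (Icc 0 L) :=
  hW.continuousOn_potential.comp (continuousOn_id.prodMk hu) fun _ ht => ⟨ht, mem_univ _⟩

lemma continuousOn_gradient_comp (hL : 0 < L) {u : ℝ → Vec n} (hu : ContinuousOn u (Icc 0 L)) :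
    ContinuousOn (fun t => ∇ (W t) (u t)) (Icc 0 L) :=
  (hW.continuousOn_gradient hL).comp (continuousOn_id.prodMk hu) fun _ ht => ⟨ht, mem_univ _⟩

/-- (W₁) says nothing at `x = 0`; both inequalities are closed conditions, and the complement of `0`
is dense as `n ≥ 1`. -/
lemma nonneg_and_le (hn : 0 < n) {t : ℝ} (hL : 0 < L) (ht : t ∈ Icc 0 L) (x : Vec n) :
    0 ≤ W t x ∧ θ * W t x ≤ inner ℝ (∇ (W t) x) x := by
  have hθ := hW.two_lt
  have : Nonempty (Fin n) := ⟨⟨0, hn⟩⟩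
  by_cases hx : x = 0
  · subst hx
    have hcl : (0 : Vec n) ∈ closure {0}ᶜ := by
      rw [(dense_compl_singleton (0 : Vec n)).closure_eq]; exact mem_univ _
    have hc1 : Continuous (W t) := continuous_iff_continuousAt.2 fun x =>
      (hW.hasFDerivAt ht x).continuousAt
    have hc2 : Continuous (fun x => ∇ (W t) x) := by
      rw [← continuousOn_univ]
      exact (hW.continuousOn_gradient hL).comp (f := fun x : Vec n => (t, x))
        (by fun_prop) fun _ _ => ⟨ht, mem_univ _⟩
    refine closure_minimal (s := {0}ᶜ) (t := {x | 0 ≤ W t x ∧ θ * W t x ≤ inner ℝ (∇ (W t) x) x})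
      (fun x hx => ?_) ?_ hcl
    · have h := hW.ambrosetti_rabinowitz t ht x hx
      exact ⟨(pos_of_mul_pos_right h.1 (by linarith)).le, h.2⟩
    · exact (isClosed_le continuous_const hc1).inter
        (isClosed_le (continuous_const.mul hc1) (hc2.inner continuous_id))
  · have h := hW.ambrosetti_rabinowitz t ht x hx
    exact ⟨(pos_of_mul_pos_right h.1 (by linarith)).le, h.2⟩

lemma exists_bound (R : ℝ) : ∃ M, ∀ t ∈ Icc 0 L, ∀ x : Vec n, ‖x‖ ≤ R →
    |W t x| ≤ M ∧ ‖∇ (W t) x‖ ≤ M := by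
  obtain ⟨Wbar, hc, hb⟩ := hW.growth
  obtain ⟨M, hM⟩ := (isCompact_closedBall (0 : Vec n) R).exists_bound_of_continuousOn
    hc.continuousOn
  refine ⟨M, fun t ht x hx => ?_⟩
  have h1 := hb t ht x
  have h2 := hM x (by simpa using hx)
  rw [Real.norm_eq_abs] at h2
  constructor <;> linarith [abs_nonneg (W t x), norm_nonneg (∇ (W t) x)]

end Conditions

end Potential

/-! ### The potential energy as a functional on the derivative space -/

section Functional

variable {n : ℕ} {α L θ : ℝ} {W : ℝ → Vec n → ℝ}

lemma WeakTendsto.exists_bound {H : Type*} [NormedAddCommGroup H] [InnerProductSpace ℝ H]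
    [CompleteSpace H] {g : ℕ → H} {w : H} (h : WeakTendsto g w) : ∃ R, ∀ k, ‖g k‖ ≤ R := by
  obtain ⟨C, hC⟩ := banach_steinhaus (g := fun k => InnerProductSpace.toDual ℝ H (g k))
    (fun x => by
      obtain ⟨C, hC⟩ := (h x).norm.bddAbove_range
      exact ⟨C, fun k => hC ⟨k, rfl⟩⟩)
  exact ⟨C, fun k => by simpa using hC k⟩

/-- Each coordinate of `A (g k)` is an inner product of `g k` with a fixed vector, given by the
adjoint; finitely many coordinates suffice. -/
lemma WeakTendsto.map {H : Type*} [NormedAddCommGroup H] [InnerProductSpace ℝ H]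
    [CompleteSpace H] {g : ℕ → H} {w : H} (h : WeakTendsto g w) (A : H →L[ℝ] Vec n) :
    Tendsto (fun k => A (g k)) atTop (𝓝 (A w)) := by
  have hb := fun x => (EuclideanSpace.basisFun (Fin n) ℝ).sum_repr' (A x)
  rw [← hb w, show (fun k => A (g k)) = _ from funext fun k => (hb (g k)).symm]
  refine tendsto_finsetSum _ fun i _ => Tendsto.smul_const ?_ _
  have h1 := h (ContinuousLinearMap.adjoint A (EuclideanSpace.basisFun (Fin n) ℝ i))
  simp_rw [ContinuousLinearMap.adjoint_inner_right] at h1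
  simpa only [real_inner_comm] using h1

lemma leftInt_coe_add_smul (hα : 1 / 2 < α) {hα' : α < 1} (g v : derivSpace (n := n) α L hα')
    (s : ℝ) {t : ℝ} (ht : t ∈ Icc 0 L) :
    leftInt α ((g + s • v : derivSpace (n := n) α L hα') : Lp (Vec n) 2 (vol L)) t =
      leftInt α (g : Lp (Vec n) 2 (vol L)) t + s • leftInt α (v : Lp (Vec n) 2 (vol L)) t := by
  obtain ⟨A, hA, -⟩ := exists_eval_clm (n := n) hα ht
  rw [← hA, ← hA, ← hA, Submodule.coe_add, Submodule.coe_smul, map_add, map_smul]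

lemma leftInt_coe_smul (hα : 1 / 2 < α) {hα' : α < 1} (g : derivSpace (n := n) α L hα')
    (s : ℝ) {t : ℝ} (ht : t ∈ Icc 0 L) :
    leftInt α ((s • g : derivSpace (n := n) α L hα') : Lp (Vec n) 2 (vol L)) t =
      s • leftInt α (g : Lp (Vec n) 2 (vol L)) t := by
  obtain ⟨A, hA, -⟩ := exists_eval_clm (n := n) hα ht
  rw [← hA, ← hA, Submodule.coe_smul, map_smul]

lemma norm_leftInt_coe_le (hα : 1 / 2 < α) {hα' : α < 1} (g : derivSpace (n := n) α L hα')
    {t : ℝ} (ht : t ∈ Icc 0 L) :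
    ‖leftInt α (g : Lp (Vec n) 2 (vol L)) t‖ ≤ supBound α L * ‖g‖ := by
  obtain ⟨A, hA, hb⟩ := exists_eval_clm (n := n) hα ht
  rw [← hA]
  exact hb g

/-- The potential part of the energy. -/
noncomputable def potentialEnergy (W : ℝ → Vec n → ℝ) {hα' : α < 1}
    (g : derivSpace (n := n) α L hα') : ℝ :=
  ∫ t in (0 : ℝ)..L, W t (leftInt α (g : Lp (Vec n) 2 (vol L)) t)

/-- The derivative of the potential part of the energy. -/
noncomputable def potentialForce (W : ℝ → Vec n → ℝ) {hα' : α < 1}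
    (g v : derivSpace (n := n) α L hα') : ℝ :=
  ∫ t in (0 : ℝ)..L, inner ℝ (∇ (W t) (leftInt α (g : Lp (Vec n) 2 (vol L)) t))
    (leftInt α (v : Lp (Vec n) 2 (vol L)) t)

instance completeSpace_derivSpace {hα' : α < 1} :
    CompleteSpace (derivSpace (n := n) α L hα') := by
  unfold derivSpace; infer_instance

instance separableSpace_derivSpace {hα' : α < 1} :
    TopologicalSpace.SeparableSpace (derivSpace (n := n) α L hα') := by
  have : Fact ((2 : ENNReal) ≠ ⊤) := ⟨by norm_num⟩
  have : SecondCountableTopology (Lp (Vec n) 2 (vol L)) := inferInstance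
  infer_instance

lemma exists_isTest_ne_zero (hn : 0 < n) (hL : 0 < L) :
    ∃ φ : ℝ → Vec n, IsTest L φ ∧ φ (L / 2) ≠ 0 := by
  let b : ContDiffBump (L / 2) := ⟨L / 8, L / 4, by positivity, by linarith⟩
  let e : Vec n := EuclideanSpace.single ⟨0, hn⟩ 1
  refine ⟨fun t => b t • e, ⟨b.contDiff.smul contDiff_const, b.hasCompactSupport.smul_right, ?_⟩, ?_⟩
  · refine (tsupport_smul_subset_left b fun _ => e).trans ?_
    rw [b.tsupport_eq, Real.closedBall_eq_Icc]
    have hb : b.rOut = L / 4 := rfl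
    exact fun t ht => ⟨by linarith [ht.1], by linarith [ht.2]⟩
  · have : b (L / 2) = 1 := b.one_of_mem_closedBall (by simp [b.rIn_pos.le])
    simp [this, e]

/-- A test function is recovered from its fractional derivative, so a nonzero bump has a nonzero
derivative class. -/
lemma nontrivial_derivSpace (hn : 0 < n) (hα : 1 / 2 < α) {hα' : α < 1} (hL : 0 < L) :
    Nontrivial (derivSpace (n := n) α L hα') := by
  obtain ⟨φ, hφ, hne⟩ := exists_isTest_ne_zero hn hL
  have hm := hφ.memLp_leftDeriv hL.le hα'
  have hmem : hm.toLp _ ∈ derivSpace (n := n) α L hα' :=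
    Submodule.le_topologicalClosure _ ⟨φ, hφ, hm.coeFn_toLp⟩
  refine ⟨⟨⟨_, hmem⟩, 0, fun h => hne ?_⟩⟩
  have ht : L / 2 ∈ Icc 0 L := ⟨by linarith, by linarith⟩
  rw [← hφ.leftInt_leftDeriv (by linarith) hα' ht, ← leftInt_congr α hm.coeFn_toLp ht.1 ht.2]
  have h0 : hm.toLp _ = 0 := congrArg Subtype.val h
  rw [h0, leftInt_congr α (Lp.coeFn_zero (Vec n) 2 (vol L)) ht.1 ht.2]
  simp [leftInt]

variable (hα : 1 / 2 < α) {hα' : α < 1} (hL : 0 < L) (hW : Conditions L θ W)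

include hα in
lemma WeakTendsto.leftInt {g : ℕ → derivSpace (n := n) α L hα'}
    {w : derivSpace (n := n) α L hα'} (h : WeakTendsto g w) {t : ℝ} (ht : t ∈ Icc 0 L) :
    Tendsto (fun k => leftInt α (g k : Lp (Vec n) 2 (vol L)) t) atTop
      (𝓝 (FracBVP.leftInt α (w : Lp (Vec n) 2 (vol L)) t)) := by
  obtain ⟨A, hA, -⟩ := exists_eval_clm (n := n) hα ht
  have := h.map (A.comp (derivSpace (n := n) α L hα').subtypeL)
  simpa [hA] using this

include hα hL

lemma continuousOn_path (g : derivSpace (n := n) α L hα') :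
    ContinuousOn (leftInt α (g : Lp (Vec n) 2 (vol L))) (Icc 0 L) :=
  continuousOn_leftInt_of_mem hα hL.le g.2

omit hα in
lemma tendsto_intervalIntegral_of_bounded {F : ℕ → ℝ → ℝ} {f : ℝ → ℝ} {M : ℝ}
    (hF : ∀ k, ContinuousOn (F k) (Icc 0 L)) (hM : ∀ k, ∀ t ∈ Icc 0 L, ‖F k t‖ ≤ M)
    (hlim : ∀ t ∈ Icc 0 L, Tendsto (fun k => F k t) atTop (𝓝 (f t))) :
    Tendsto (fun k => ∫ t in (0 : ℝ)..L, F k t) atTop (𝓝 (∫ t in (0 : ℝ)..L, f t)) := by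
  have hsub : uIoc 0 L ⊆ Icc 0 L := by rw [uIoc_of_le hL.le]; exact Ioc_subset_Icc_self
  refine intervalIntegral.tendsto_integral_filter_of_dominated_convergence (fun _ => M)
    (Eventually.of_forall fun k => ?_)
    (Eventually.of_forall fun k => Eventually.of_forall fun t ht => hM k t (hsub ht))
    intervalIntegrable_const (Eventually.of_forall fun t ht => hlim t (hsub ht))
  exact ((hF k).mono hsub).aestronglyMeasurable measurableSet_uIoc

include hW

lemma continuousOn_force (g v : derivSpace (n := n) α L hα') :
    ContinuousOn (fun t => inner ℝ (∇ (W t) (leftInt α (g : Lp (Vec n) 2 (vol L)) t))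
      (leftInt α (v : Lp (Vec n) 2 (vol L)) t)) (Icc 0 L) :=
  (hW.continuousOn_gradient_comp hL (continuousOn_path hα hL g)).inner
    (continuousOn_path hα hL v)

lemma intervalIntegrable_force (g v : derivSpace (n := n) α L hα') :
    IntervalIntegrable (fun t => inner ℝ (∇ (W t) (leftInt α (g : Lp (Vec n) 2 (vol L)) t))
      (leftInt α (v : Lp (Vec n) 2 (vol L)) t)) volume 0 L :=
  (continuousOn_force hα hL hW g v).intervalIntegrable_of_Icc hL.le

lemma intervalIntegrable_potential (g : derivSpace (n := n) α L hα') :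
    IntervalIntegrable (fun t => W t (leftInt α (g : Lp (Vec n) 2 (vol L)) t)) volume 0 L :=
  (hW.continuousOn_potential_comp (continuousOn_path hα hL g)).intervalIntegrable_of_Icc hL.le

/-- Weakly convergent sequences are norm bounded, so the paths are uniformly bounded and converge
pointwise; (W₃) bounds the integrand for dominated convergence. -/
lemma potentialEnergy_tendsto {g : ℕ → derivSpace (n := n) α L hα'}
    {w : derivSpace (n := n) α L hα'} (h : WeakTendsto g w) :
    Tendsto (fun k => potentialEnergy W (g k)) atTop (𝓝 (potentialEnergy W w)) := by
  obtain ⟨R, hR⟩ := h.exists_bound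
  obtain ⟨M, hM⟩ := hW.exists_bound (supBound α L * R)
  have hC := supBound_nonneg hα L
  refine tendsto_intervalIntegral_of_bounded hL (M := M)
    (fun k => hW.continuousOn_potential_comp (continuousOn_path hα hL (g k)))
    (fun k t ht => ?_) (fun t ht => ?_)
  · exact (hM t ht _ ((norm_leftInt_coe_le hα (g k) ht).trans
      (mul_le_mul_of_nonneg_left (hR k) hC))).1
  · exact ((hW.hasFDerivAt ht _).continuousAt.tendsto).comp (h.leftInt hα ht)

lemma potentialForce_tendsto {g h : ℕ → derivSpace (n := n) α L hα'}
    {w v : derivSpace (n := n) α L hα'} (hg : WeakTendsto g w) (hh : WeakTendsto h v) :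
    Tendsto (fun k => potentialForce W (g k) (h k)) atTop (𝓝 (potentialForce W w v)) := by
  obtain ⟨R, hR⟩ := hg.exists_bound
  obtain ⟨R', hR'⟩ := hh.exists_bound
  obtain ⟨M, hM⟩ := hW.exists_bound (supBound α L * R)
  have hC := supBound_nonneg hα L
  refine tendsto_intervalIntegral_of_bounded hL (M := M * (supBound α L * R'))
    (fun k => continuousOn_force hα hL hW (g k) (h k)) (fun k t ht => ?_) (fun t ht => ?_)
  · have h1 := (hM t ht _ ((norm_leftInt_coe_le hα (g k) ht).trans
      (mul_le_mul_of_nonneg_left (hR k) hC))).2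
    have h2 := (norm_leftInt_coe_le hα (h k) ht).trans (mul_le_mul_of_nonneg_left (hR' k) hC)
    exact (norm_inner_le_norm _ _).trans
      (mul_le_mul h1 h2 (norm_nonneg _) ((norm_nonneg _).trans h1))
  · have hc : Continuous (fun x => ∇ (W t) x) := by
      rw [← continuousOn_univ]
      exact (hW.continuousOn_gradient hL).comp (f := fun x : Vec n => (t, x))
        (by fun_prop) fun _ _ => ⟨ht, mem_univ _⟩
    exact ((hc.tendsto _).comp (hg.leftInt hα ht)).inner (hh.leftInt hα ht)

lemma hasDerivAt_potentialEnergy (g v : derivSpace (n := n) α L hα') (s : ℝ) :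
    HasDerivAt (fun s : ℝ => potentialEnergy W (g + s • v)) (potentialForce W (g + s • v) v) s := by
  have hsub : uIoc 0 L ⊆ Icc 0 L := by rw [uIoc_of_le hL.le]; exact Ioc_subset_Icc_self
  have hC := supBound_nonneg hα L
  -- Bounds `‖g + r • v‖` for all `r` within distance `1` of `s`.
  set R := ‖g‖ + (|s| + 1) * ‖v‖
  obtain ⟨M, hM⟩ := hW.exists_bound (supBound α L * R)
  have hint := fun r : ℝ => intervalIntegrable_potential hα hL hW (g + r • v)
  refine (intervalIntegral.hasDerivAt_integral_of_dominated_loc_of_deriv_le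
    (F := fun r t => W t (leftInt α ((g + r • v : derivSpace (n := n) α L hα') :
      Lp (Vec n) 2 (vol L)) t))
    (F' := fun r t => inner ℝ (∇ (W t) (leftInt α ((g + r • v : derivSpace (n := n) α L hα') :
      Lp (Vec n) 2 (vol L)) t)) (leftInt α (v : Lp (Vec n) 2 (vol L)) t))
    (bound := fun _ => M * (supBound α L * ‖v‖))
    (Metric.ball_mem_nhds s one_pos) (Eventually.of_forall fun r => ?_) (hint s) ?_
    (Eventually.of_forall fun t ht r hr => ?_) intervalIntegrable_const
    (Eventually.of_forall fun t ht r hr => ?_)).2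
  · exact (intervalIntegrable_iff.1 (hint r)).aestronglyMeasurable
  · exact (intervalIntegrable_iff.1
      (intervalIntegrable_force hα hL hW (g + s • v) v)).aestronglyMeasurable
  · have hr' : ‖g + r • v‖ ≤ R := by
      refine (norm_add_le _ _).trans ?_
      rw [norm_smul]
      have : ‖r‖ ≤ |s| + 1 := by
        rw [Metric.mem_ball, Real.dist_eq] at hr
        have := abs_sub_abs_le_abs_sub r s
        rw [Real.norm_eq_abs]; linarith
      exact add_le_add le_rfl (mul_le_mul_of_nonneg_right this (norm_nonneg _))
    have h1 := (hM t (hsub ht) _ ((norm_leftInt_coe_le hα (g + r • v) (hsub ht)).trans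
      (mul_le_mul_of_nonneg_left hr' hC))).2
    exact (norm_inner_le_norm _ _).trans
      (mul_le_mul h1 (norm_leftInt_coe_le hα v (hsub ht)) (norm_nonneg _)
        ((norm_nonneg _).trans h1))
  · have e := fun r : ℝ => leftInt_coe_add_smul hα g v r (hsub ht)
    set a := leftInt α (g : Lp (Vec n) 2 (vol L)) t
    set b := leftInt α (v : Lp (Vec n) 2 (vol L)) t
    have h1 : HasDerivAt (fun r : ℝ => a + r • b) b r := by
      simpa using ((hasDerivAt_id r).smul_const b).const_add a
    have h2 := (hW.hasGradientAt (hsub ht) (a + r • b)).hasFDerivAt.comp_hasDerivAt r h1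
    simp only [e]
    simpa [Function.comp_def] using h2

/-- Apply (W₄) at each `t` with `q` the value of the path. The integrands are continuous, so strict
inequality at a single `t₀` where the path is nonzero is enough. -/
lemma potentialForce_strictMonoOn {g : derivSpace (n := n) α L hα'} (hg : g ≠ 0) :
    StrictMonoOn (fun s : ℝ => potentialForce W (s • g) g / s ^ (θ - 1)) (Ioi 0) := by
  intro s hs r hr hsr
  have hs' : (0 : ℝ) < s := hs
  have hr' : (0 : ℝ) < r := hr
  simp only [potentialForce]
  rw [← intervalIntegral.integral_div, ← intervalIntegral.integral_div]
  obtain ⟨t₀, ht₀, hne⟩ : ∃ t ∈ Icc 0 L, leftInt α (g : Lp (Vec n) 2 (vol L)) t ≠ 0 := by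
    by_contra! h
    refine hg (Subtype.ext ?_)
    rw [Submodule.coe_zero, ← leftInt_ae_eq_zero_iff hα (hα' := hα') hL.le]
    filter_upwards [ae_vol_mem L] with t ht using h t (Ioo_subset_Icc_self ht)
  have hcont := fun s : ℝ => (continuousOn_force hα hL hW (s • g) g).div_const (s ^ (θ - 1))
  have hlt : ∀ t ∈ Icc 0 L, leftInt α (g : Lp (Vec n) 2 (vol L)) t ≠ 0 →
      inner ℝ (∇ (W t) (leftInt α ((s • g : derivSpace (n := n) α L hα') :
        Lp (Vec n) 2 (vol L)) t)) (leftInt α (g : Lp (Vec n) 2 (vol L)) t) / s ^ (θ - 1) <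
      inner ℝ (∇ (W t) (leftInt α ((r • g : derivSpace (n := n) α L hα') :
        Lp (Vec n) 2 (vol L)) t)) (leftInt α (g : Lp (Vec n) 2 (vol L)) t) / r ^ (θ - 1) := by
    intro t ht hq
    rw [leftInt_coe_smul hα g s ht, leftInt_coe_smul hα g r ht]
    exact hW.strictMono t ht _ hq hs hr hsr
  refine intervalIntegral.integral_lt_integral_of_continuousOn_of_le_of_exists_lt hL
    (hcont s) (hcont r) (fun t ht => ?_) ⟨t₀, ht₀, hlt t₀ ht₀ hne⟩
  by_cases hq : leftInt α (g : Lp (Vec n) 2 (vol L)) t = 0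
  · simp [hq]
  · exact (hlt t (Ioc_subset_Icc_self ht) hq).le

lemma potentialForce_small : ∀ ε > 0, ∃ δ > 0, ∀ g : derivSpace (n := n) α L hα', ‖g‖ < δ →
    potentialForce W g g ≤ ε * ‖g‖ ^ 2 := by
  intro ε hε
  set C := supBound α L
  have hC : 0 ≤ C := supBound_nonneg hα L
  -- Chosen so that integrating over length `L` with paths bounded by `C * ‖g‖` leaves the factor `C
  -- ^ 2 / (C ^ 2 + 1) ≤ 1`; the added `1` covers `C = 0`.
  obtain ⟨δ, hδ, h⟩ := hW.small_o (ε / (L * (C ^ 2 + 1))) (by positivity)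
  refine ⟨δ / (C + 1), by positivity, fun g hg => ?_⟩
  have hb : ∀ t ∈ Icc 0 L, inner ℝ (∇ (W t) (leftInt α (g : Lp (Vec n) 2 (vol L)) t))
      (leftInt α (g : Lp (Vec n) 2 (vol L)) t) ≤ ε / (L * (C ^ 2 + 1)) * (C * ‖g‖) ^ 2 := by
    intro t ht
    have h1 := norm_leftInt_coe_le hα g ht
    have h2 : ‖leftInt α (g : Lp (Vec n) 2 (vol L)) t‖ < δ := by
      refine h1.trans_lt ?_
      rw [lt_div_iff₀ (by positivity)] at hg
      nlinarith [norm_nonneg g]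
    have h3 := h t ht _ h2
    calc _ ≤ ‖∇ (W t) (leftInt α (g : Lp (Vec n) 2 (vol L)) t)‖ *
          ‖leftInt α (g : Lp (Vec n) 2 (vol L)) t‖ := real_inner_le_norm _ _
      _ ≤ (ε / (L * (C ^ 2 + 1)) * ‖leftInt α (g : Lp (Vec n) 2 (vol L)) t‖) *
          ‖leftInt α (g : Lp (Vec n) 2 (vol L)) t‖ := by gcongr
      _ = ε / (L * (C ^ 2 + 1)) * ‖leftInt α (g : Lp (Vec n) 2 (vol L)) t‖ ^ 2 := by ring
      _ ≤ _ := by gcongr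
  have h4 := intervalIntegral.integral_mono_on hL.le (intervalIntegrable_force hα hL hW g g)
    intervalIntegrable_const hb
  rw [intervalIntegral.integral_const, smul_eq_mul, sub_zero] at h4
  refine h4.trans ?_
  have e : L * (ε / (L * (C ^ 2 + 1)) * (C * ‖g‖) ^ 2) =
      ε * ‖g‖ ^ 2 * (C ^ 2 / (C ^ 2 + 1)) := by field_simp
  rw [e]
  refine mul_le_of_le_one_right (by positivity) ?_
  rw [div_le_one (by positivity)]; linarith

theorem superquadratic_potentialEnergy (hn : 0 < n) :
    Superquadratic θ (potentialEnergy (n := n) (α := α) (L := L) (hα' := hα') W)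
      (potentialForce W) where
  two_lt := hW.two_lt
  smul_right g c v := by
    rw [potentialForce, potentialForce, ← intervalIntegral.integral_const_mul]
    refine intervalIntegral.integral_congr fun t ht => ?_
    rw [uIcc_of_le hL.le] at ht
    simp only [leftInt_coe_smul hα v c ht, real_inner_smul_right]
  hasDerivAt := hasDerivAt_potentialEnergy hα hL hW
  weak_cont := potentialEnergy_tendsto hα hL hW
  weak_cont_deriv := potentialForce_tendsto hα hL hW
  nonneg g := intervalIntegral.integral_nonneg hL.le fun t ht => (hW.nonneg_and_le hn hL ht _).1
  le_deriv g := by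
    rw [potentialEnergy, potentialForce, ← intervalIntegral.integral_const_mul]
    exact intervalIntegral.integral_mono_on hL.le
      ((intervalIntegrable_potential hα hL hW g).const_mul θ)
      (intervalIntegrable_force hα hL hW g g) fun t ht => (hW.nonneg_and_le hn hL ht _).2
  small := potentialForce_small hα hL hW
  strictMono _ hg := potentialForce_strictMonoOn hα hL hW hg

end Functional

/-! ### The du Bois-Reymond lemma -/

section DuBoisReymond

variable {n : ℕ} {L : ℝ}

lemma exists_Icc_of_isCompact_subset_Ioo (hL : 0 < L) {K : Set ℝ} (hK : IsCompact K)
    (hKL : K ⊆ Ioo 0 L) : ∃ a b, 0 < a ∧ b < L ∧ K ⊆ Icc a b := by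
  rcases K.eq_empty_or_nonempty with rfl | hne
  · exact ⟨L / 2, L / 2, by linarith, by linarith, empty_subset _⟩
  · obtain ⟨a, ha⟩ := hK.exists_isLeast hne
    obtain ⟨b, hb⟩ := hK.exists_isGreatest hne
    exact ⟨a, b, (hKL ha.1).1, (hKL hb.1).2, fun x hx => ⟨ha.2 hx, hb.2 hx⟩⟩

/-- A smooth compactly supported function of mean zero is the derivative of another one. -/
lemma exists_primitive (hL : 0 < L) {χ : ℝ → ℝ} (hχ : ContDiff ℝ ∞ χ)
    (hc : HasCompactSupport χ) (hs : tsupport χ ⊆ Ioo 0 L) (h0 : ∫ t, χ t = 0) :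
    ∃ Φ : ℝ → ℝ, ContDiff ℝ ∞ Φ ∧ HasCompactSupport Φ ∧ tsupport Φ ⊆ Ioo 0 L ∧
      deriv Φ = χ := by
  obtain ⟨a, b, ha, hb, hab⟩ := exists_Icc_of_isCompact_subset_Ioo hL hc.isCompact hs
  set Φ : ℝ → ℝ := fun t => ∫ s in (0 : ℝ)..t, χ s
  have hd : ∀ t, HasDerivAt Φ (χ t) t := fun t =>
    intervalIntegral.integral_hasDerivAt_right (hχ.continuous.intervalIntegrable _ _)
      hχ.continuous.stronglyMeasurable.stronglyMeasurableAtFilter hχ.continuous.continuousAt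
  have hder : deriv Φ = χ := funext fun t => (hd t).deriv
  have hz : ∀ t, t ∉ Icc a b → χ t = 0 := fun t ht =>
    image_eq_zero_of_notMem_tsupport fun h => ht (hab h)
  have hsupp : Function.support Φ ⊆ Icc a b := by
    intro t ht
    by_contra hn
    refine ht ?_
    rw [mem_Icc, not_and_or, not_le, not_le] at hn
    rcases hn with h | h
    · refine (intervalIntegral.integral_congr (g := fun _ => (0 : ℝ)) fun s hs => ?_).trans
        (by simp)
      refine hz s fun h' => ?_
      have : s ≤ max 0 t := hs.2
      exact absurd (h'.1.trans this) (not_le.2 (max_lt ha h))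
    -- To the right of `b` the primitive equals the full integral of `χ`, which is zero.
    · have : Function.support χ ⊆ Ioc 0 t := fun s hs' => by
        have h' := hab (subset_tsupport χ hs')
        exact ⟨ha.trans_le h'.1, h'.2.trans h.le⟩
      simp only [Φ]
      rw [intervalIntegral.integral_eq_integral_of_support_subset this, h0]
  have htsupp : tsupport Φ ⊆ Icc a b := closure_minimal hsupp isClosed_Icc
  refine ⟨Φ, contDiff_infty_iff_deriv.2 ⟨fun t => (hd t).differentiableAt, hder ▸ hχ⟩,
    isCompact_Icc.of_isClosed_subset (isClosed_tsupport _) htsupp, fun t ht => ?_, hder⟩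
  exact ⟨ha.trans_le (htsupp ht).1, (htsupp ht).2.trans_lt hb⟩

/-- Lemma of du Bois-Reymond. -/
lemma exists_ae_eq_const (hL : 0 < L) {Q : ℝ → Vec n} (hQ : Integrable Q (vol L))
    (h : ∀ φ : ℝ → Vec n, IsTest L φ → ∫ t in (0 : ℝ)..L, inner ℝ (Q t) (deriv φ t) = 0) :
    ∃ c : Vec n, Q =ᵐ[vol L] fun _ => c := by
  let b : ContDiffBump (L / 2) := ⟨L / 8, L / 4, by positivity, by linarith⟩
  have hbsupp : tsupport (b.normed volume) ⊆ Ioo 0 L := by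
    rw [b.tsupport_normed_eq, Real.closedBall_eq_Icc]
    have hb : b.rOut = L / 4 := rfl
    exact fun t ht => ⟨by linarith [ht.1], by linarith [ht.2]⟩
  set η := b.normed volume
  have hη : ContDiff ℝ ∞ η := b.contDiff_normed
  have hηc : HasCompactSupport η := b.hasCompactSupport_normed
  have hη1 : ∫ t, η t = 1 := b.integral_normed
  have hmul : ∀ χ : ℝ → ℝ, Continuous χ → Integrable (fun t => χ t • Q t) (vol L) := by
    intro χ hχ
    obtain ⟨M, hM⟩ := (isCompact_Icc (a := 0) (b := L)).exists_bound_of_continuousOn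
      hχ.continuousOn
    refine hQ.bdd_smul M hχ.aestronglyMeasurable ?_
    filter_upwards [ae_vol_mem L] with t ht using hM t (Ioo_subset_Icc_self ht)
  -- Test with `Φ • e`, where `Φ' = χ` and `e` is the integral in question: the hypothesis then
  -- reads `⟨e, e⟩ = 0`.
  have hzero : ∀ χ : ℝ → ℝ, ContDiff ℝ ∞ χ → HasCompactSupport χ → tsupport χ ⊆ Ioo 0 L →
      ∫ t, χ t = 0 → ∫ t, χ t • Q t ∂vol L = 0 := by
    intro χ hχ hc hs h0
    obtain ⟨Φ, hΦ, hΦc, hΦs, hΦd⟩ := exists_primitive hL hχ hc hs h0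
    set e := ∫ t, χ t • Q t ∂vol L with he
    have ht : IsTest L (fun t => Φ t • e) :=
      ⟨hΦ.smul contDiff_const, hΦc.smul_right,
        (tsupport_smul_subset_left Φ fun _ => e).trans hΦs⟩
    have h1 := h _ ht
    have h2 : ∀ t, deriv (fun t => Φ t • e) t = χ t • e := fun t => by
      rw [deriv_smul_const (hΦ.differentiable (by simp)).differentiableAt, hΦd]
    simp_rw [h2] at h1
    rw [← integral_vol hL.le] at h1
    have h3 : ∫ t, inner ℝ (Q t) (χ t • e) ∂vol L = inner ℝ e e := by
      conv_rhs => rw [he, ← he, real_inner_comm]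
      rw [← integral_inner (hmul χ hχ.continuous) e]
      refine integral_congr_ae (Eventually.of_forall fun t => ?_)
      simp only [real_inner_smul_right]
      rw [real_inner_comm]
    rw [h3] at h1
    exact inner_self_eq_zero.1 h1
  set c := ∫ t, η t • Q t ∂vol L
  refine ⟨c, ?_⟩
  have hae : ∀ᵐ t ∂volume, t ∈ Ioo 0 L → Q t - c = 0 := by
    refine isOpen_Ioo.ae_eq_zero_of_integral_contDiff_smul_eq_zero (f := fun t => Q t - c) ?_ ?_
    · have : IntegrableOn (fun t => Q t - c) (Ioo 0 L) := hQ.sub (integrable_const c)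
      exact this.locallyIntegrableOn
    · intro ψ hψ hψc hψs
      have hψz : ∀ t, t ∉ Ioo 0 L → ψ t = 0 := fun t ht =>
        image_eq_zero_of_notMem_tsupport fun h => ht (hψs h)
      set m := ∫ t, ψ t with hm
      have hψi : Integrable ψ := hψ.continuous.integrable_of_hasCompactSupport hψc
      have hηi : Integrable η := hη.continuous.integrable_of_hasCompactSupport hηc
      have hmη : HasCompactSupport fun t => m * η t := hηc.mul_left (f := fun _ => m)
      -- Subtracting `m * η` removes the mean of `ψ`, as `η` has integral one; the constant is
      -- accordingly the `η`-average of `Q`.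
      have h1 := hzero (fun t => ψ t - m * η t) (hψ.sub (contDiff_const.mul hη))
        (hψc.sub hmη)
        ((tsupport_sub ψ fun t => m * η t).trans (union_subset hψs
          ((tsupport_mul_subset_right (f := fun _ => m) (g := η)).trans hbsupp))) (by
            rw [integral_sub hψi (hηi.const_mul m), integral_const_mul, hη1]; simp [hm])
      rw [← setIntegral_eq_integral_of_forall_compl_eq_zero (s := Ioo 0 L)
        (fun t ht => by rw [hψz t ht, zero_smul])]
      change ∫ t, ψ t • (Q t - c) ∂vol L = 0
      have hm' : ∫ t, ψ t ∂vol L = m :=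
        setIntegral_eq_integral_of_forall_compl_eq_zero hψz
      simp_rw [smul_sub]
      simp_rw [sub_smul, mul_smul] at h1
      have hηm : Integrable (fun t => m • η t • Q t) (vol L) := (hmul η hη.continuous).smul m
      rw [integral_sub (hmul ψ hψ.continuous) hηm, integral_smul] at h1
      rw [integral_sub (hmul ψ hψ.continuous) (hψi.restrict.smul_const c), integral_smul_const,
        hm']
      exact h1
  have := ae_restrict_of_ae (s := Ioo 0 L) hae
  filter_upwards [this, ae_vol_mem L] with t h1 ht
  exact sub_eq_zero.1 (h1 ht)

end DuBoisReymond

/-! ### From weak solutions to the pointwise equation -/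

section EulerLagrange

variable {n : ℕ} {α L : ℝ}

lemma integrable_inner_of_memLp {f g : ℝ → Vec n} (hf : MemLp f 2 (vol L))
    (hg : MemLp g 2 (vol L)) : Integrable (fun t => inner ℝ (f t) (g t)) (vol L) := by
  refine (L2.integrable_inner (𝕜 := ℝ) (hf.toLp f) (hg.toLp g)).congr ?_
  filter_upwards [hf.coeFn_toLp, hg.coeFn_toLp] with t h1 h2
  rw [h1, h2]

lemma rightInt_const {β : ℝ} (hβ : 0 < β) (c : Vec n) {t : ℝ} (ht : t ∈ Icc 0 L) :
    rightInt β L (fun _ => c) t = ((Real.Gamma β)⁻¹ * ((L - t) ^ β / β)) • c := by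
  rw [rightInt_eq_integral_ker β _ ht.1 ht.2, integral_smul_const,
    integral_ker_right hβ ht.1 ht.2, smul_smul]

/-- Elements of `L²` orthogonal to the fractional derivatives of all test functions. -/
lemma exists_integral_eq_of_orthogonal (hα : 0 < α) (hα' : α < 1) (hL : 0 < L) {q : ℝ → Vec n}
    (hq : Integrable q (vol L))
    (h : ∀ φ : ℝ → Vec n, IsTest L φ →
      ∫ t in (0 : ℝ)..L, inner ℝ (q t) (leftDeriv α φ t) = 0) :
    ∃ c : Vec n, ∀ t ∈ Icc 0 L,
      ∫ s in t..L, q s = ((Real.Gamma α)⁻¹ * ((L - t) ^ α / α)) • c := by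
  have hβ : 0 < 1 - α := by linarith
  -- Since `leftDeriv α φ` is the integral of order `1 - α` of `φ'`, integration by parts makes
  -- `rightInt (1 - α) L q` orthogonal to every `φ'`.
  obtain ⟨c, hc⟩ := exists_ae_eq_const hL (integrable_rightInt hL.le hβ hq) fun φ hφ => by
    obtain ⟨M, hM⟩ := (isCompact_Icc (a := 0) (b := L)).exists_bound_of_continuousOn
      hφ.deriv.1.continuous.continuousOn
    rw [← integral_inner_leftInt' hL.le hβ hq
      (integrable_vol_of_continuousOn hφ.deriv.1.continuous.continuousOn)
      (fun t ht => hM t (Ioo_subset_Icc_self ht)), ← integral_vol hL.le]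
    refine Eq.trans (integral_congr_ae ?_) ((integral_vol hL.le _).trans (h φ hφ))
    filter_upwards [ae_vol_mem L] with t ht
    rw [hφ.leftDeriv_eq hα' ht]
  refine ⟨c, fun t ht => ?_⟩
  rw [← rightInt_rightInt hα hβ (by ring) ht.1 ht.2 hq, rightInt_congr α hc ht.1 ht.2,
    rightInt_const hα c ht]

variable (hα : 1 / 2 < α) (hα' : α < 1) (hL : 0 < L)
  {g : Lp (Vec n) 2 (vol L)} {f : ℝ → Vec n} (hf : ContinuousOn f (Icc 0 L))
  (hweak : ∀ φ : ℝ → Vec n, IsTest L φ →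
    ∫ t in (0 : ℝ)..L, inner ℝ (g t) (leftDeriv α φ t) = ∫ t in (0 : ℝ)..L, inner ℝ (f t) (φ t))

include hα hα' hL hf hweak

/-- Pointwise formula for the fractional derivative of a weak solution. -/
lemma exists_hasDerivAt_leftInt_of_weak : ∃ c : Vec n, ∀ t ∈ Ioo 0 L,
    HasDerivAt (leftInt (1 - α) (leftInt α g))
      (rightInt α L f t + ((Real.Gamma α)⁻¹ * ker α (L - t)) • c) t := by
  have hα0 : 0 < α := by linarith
  set p := rightInt α L f with hp
  have hpc : ContinuousOn p (Icc 0 L) := continuousOn_rightInt hα0 hL.le hf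
  have hpi : Integrable p (vol L) := integrable_vol_of_continuousOn hpc
  have hgi : Integrable g (vol L) := (Lp.memLp g).integrable (by norm_num)
  obtain ⟨M, hM⟩ := isCompact_Icc.exists_bound_of_continuousOn hf
  -- Since `φ` is the integral of order `α` of its derivative, the right side of `hweak` is a
  -- pairing of `rightInt α L f` with `leftDeriv α φ`.
  obtain ⟨c, hc⟩ := exists_integral_eq_of_orthogonal (q := fun t => g t - p t) hα0 hα' hL
    (hgi.sub hpi) fun φ hφ => by
      have hD := hφ.memLp_leftDeriv hL.le hα'
      have h1 := hweak φ hφ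
      have h2 : ∫ t in (0 : ℝ)..L, inner ℝ (f t) (φ t) =
          ∫ t in (0 : ℝ)..L, inner ℝ (p t) (leftDeriv α φ t) := by
        rw [hp, ← integral_inner_leftInt hL.le hα0 (M := M)
          (aestronglyMeasurable_vol_of_continuousOn hf) (by
            filter_upwards [ae_vol_mem L] with t ht using hM t (Ioo_subset_Icc_self ht))
          (hD.integrable (by norm_num))]
        refine intervalIntegral.integral_congr fun t ht => ?_
        rw [uIcc_of_le hL.le] at ht
        simp only [hφ.leftInt_leftDeriv hα0 hα' ht]
      simp_rw [inner_sub_left]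
      rw [intervalIntegral.integral_sub, h1, h2, sub_self]
      · exact (integrable_vol_iff hL.le).1 (integrable_inner_of_memLp (Lp.memLp g) hD)
      · exact (integrable_vol_iff hL.le).1
          (integrable_inner_of_memLp (memLp_vol_of_continuousOn hpc) hD)
  refine ⟨c, fun t ht => ?_⟩
  have hg' : IntervalIntegrable g volume 0 L := (integrable_vol_iff hL.le).1 hgi
  have hp' : IntervalIntegrable p volume 0 L := (integrable_vol_iff hL.le).1 hpi
  have hsubI : ∀ x ∈ Ioo 0 L, uIcc x L ⊆ uIcc 0 L ∧ uIcc 0 x ⊆ uIcc 0 L := fun x hx => by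
    rw [uIcc_of_le hx.2.le, uIcc_of_le hL.le, uIcc_of_le hx.1.le]
    exact ⟨Icc_subset_Icc_left hx.1.le, Icc_subset_Icc_right hx.2.le⟩
  -- The function `∫₀ˣ g` is expressed at every interior `x` through terms differentiable there,
  -- which upgrades the almost everywhere derivative to an everywhere one.
  have hform : ∀ x ∈ Ioo 0 L, leftInt (1 - α) (leftInt α g) x =
      (∫ s in (0 : ℝ)..L, g s) - (∫ s in x..L, p s) -
        ((Real.Gamma α)⁻¹ * ((L - x) ^ α / α)) • c := fun x hx => by
    have h1 := hc x (Ioo_subset_Icc_self hx)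
    rw [intervalIntegral.integral_sub (hg'.mono_set (hsubI x hx).1)
      (hp'.mono_set (hsubI x hx).1)] at h1
    rw [leftInt_leftInt_Lp hα (hα' := hα') g (Ioo_subset_Icc_self hx), ← h1,
      ← intervalIntegral.integral_add_adjacent_intervals (hg'.mono_set (hsubI x hx).2)
        (hg'.mono_set (hsubI x hx).1)]
    abel
  have hpd : HasDerivAt (fun x => ∫ s in x..L, p s) (-p t) t := by
    refine intervalIntegral.integral_hasDerivAt_left (hp'.mono_set (hsubI t ht).1) ?_ ?_
    · exact (hpc.mono Ioo_subset_Icc_self).stronglyMeasurableAtFilter isOpen_Ioo t ht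
    · exact hpc.continuousAt (Icc_mem_nhds ht.1 ht.2)
  have hLt : 0 < L - t := sub_pos.2 ht.2
  have hpow : HasDerivAt (fun x : ℝ => (Real.Gamma α)⁻¹ * ((L - x) ^ α / α))
      (-((Real.Gamma α)⁻¹ * ker α (L - t))) t := by
    have h1 : HasDerivAt (fun x : ℝ => L - x) (-1) t := by
      simpa using (hasDerivAt_id t).const_sub L
    have h2 := ((h1.rpow_const (p := α) (Or.inl hLt.ne')).div_const α).const_mul
      (Real.Gamma α)⁻¹
    convert! h2 using 1
    rw [ker_of_pos hLt]
    field_simp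
  have htot := ((hpd.const_sub (∫ s in (0 : ℝ)..L, g s)).sub (hpow.smul_const c))
  rw [neg_neg, neg_smul, sub_neg_eq_add] at htot
  refine htot.congr_of_eventuallyEq ?_
  filter_upwards [Ioo_mem_nhds ht.1 ht.2] with x hx
  exact hform x hx

/-- Weak solutions satisfy the equation at every interior point. -/
lemma hasDerivAt_rightInt_of_weak {t : ℝ} (ht : t ∈ Ioo 0 L) :
    DifferentiableAt ℝ (leftInt (1 - α) (leftInt α g)) t ∧
      HasDerivAt (rightInt (1 - α) L (leftDeriv α (leftInt α g))) (-f t) t := by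
  have hα0 : 0 < α := by linarith
  have hβ : 0 < 1 - α := by linarith
  obtain ⟨c, hc⟩ := exists_hasDerivAt_leftInt_of_weak hα hα' hL hf hweak
  refine ⟨(hc t ht).differentiableAt, ?_⟩
  have hpc : ContinuousOn (rightInt α L f) (Icc 0 L) := continuousOn_rightInt hα0 hL.le hf
  obtain ⟨M, hM⟩ := isCompact_Icc.exists_bound_of_continuousOn hpc
  have hae : leftDeriv α (leftInt α g) =ᵐ[vol L]
      fun t => rightInt α L f t + ((Real.Gamma α)⁻¹ * ker α (L - t)) • c := by
    filter_upwards [ae_vol_mem L] with x hx using (hc x hx).deriv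
  -- The singular term `c (L - s)^(α-1) / Γ(α)` integrates to the constant `c` by the beta integral,
  -- so it disappears on differentiation.
  have hform : ∀ x ∈ Ioo 0 L, rightInt (1 - α) L (leftDeriv α (leftInt α g)) x =
      (∫ s in x..L, f s) + c := fun x hx => by
    have hi1 : Integrable (fun s => ker (1 - α) (s - x) • rightInt α L f s) (vol L) := by
      refine (integrable_ker_right hβ x L hL.le).smul_bdd M
        (aestronglyMeasurable_vol_of_continuousOn hpc) ?_
      filter_upwards [ae_vol_mem L] with s hs using hM s (Ioo_subset_Icc_self hs)
    have e : ∀ s, ker (1 - α) (s - x) • ((Real.Gamma α)⁻¹ * ker α (L - s)) • c =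
        (Real.Gamma α)⁻¹ • (ker α (L - s) * ker (1 - α) (s - x)) • c := fun s => by
      rw [smul_smul, smul_smul]; congr 1; ring
    have hi2 : Integrable (fun s => (Real.Gamma α)⁻¹ •
        (ker α (L - s) * ker (1 - α) (s - x)) • c) (vol L) :=
      ((integrable_ker_mul_ker hα0 hβ (by ring) hx.1.le hx.2).smul_const c).smul (Real.Gamma α)⁻¹
    rw [rightInt_congr _ hae hx.1.le hx.2.le, rightInt_eq_integral_ker _ _ hx.1.le hx.2.le]
    simp_rw [smul_add, e]
    rw [integral_add hi1 hi2, integral_smul, integral_smul_const,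
      integral_ker_mul_ker hα0 hβ (by ring) hx.1.le hx.2, smul_add,
      ← rightInt_eq_integral_ker _ _ hx.1.le hx.2.le,
      rightInt_rightInt hβ hα0 (by ring) hx.1.le hx.2.le (integrable_vol_of_continuousOn hf),
      smul_smul, smul_smul]
    have h1 := (Real.Gamma_pos_of_pos hα0).ne'
    have h2 := (Real.Gamma_pos_of_pos hβ).ne'
    rw [show (Real.Gamma (1 - α))⁻¹ * (Real.Gamma α)⁻¹ * (Real.Gamma α * Real.Gamma (1 - α)) = 1 by
      field_simp, one_smul]
  have hfi : IntervalIntegrable f volume t L :=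
    (hf.mono (Icc_subset_Icc_left ht.1.le)).intervalIntegrable_of_Icc ht.2.le
  have hfd : HasDerivAt (fun x => ∫ s in x..L, f s) (-f t) t := by
    refine intervalIntegral.integral_hasDerivAt_left hfi ?_ ?_
    · exact (hf.mono Ioo_subset_Icc_self).stronglyMeasurableAtFilter isOpen_Ioo t ht
    · exact hf.continuousAt (Icc_mem_nhds ht.1 ht.2)
  refine (hfd.add_const c).congr_of_eventuallyEq ?_
  filter_upwards [Ioo_mem_nhds ht.1 ht.2] with x hx
  exact hform x hx

end EulerLagrange

/-! ### Transfer back to functions -/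

section GroundState

variable {n : ℕ} {α L : ℝ} {hα' : α < 1} {W : ℝ → Vec n → ℝ}

/-- Stated for an arbitrary representative `u`, since competitors in the Nehari set are determined
only almost everywhere. -/
lemma energy_eq_action (hL : 0 ≤ L) {u : ℝ → Vec n} {g : derivSpace (n := n) α L hα'}
    (hu : u =ᵐ[vol L] leftInt α (g : Lp (Vec n) 2 (vol L)))
    (hd : leftDeriv α u =ᵐ[vol L] (g : Lp (Vec n) 2 (vol L))) :
    energy α L W u = action (potentialEnergy W) g := by
  rw [energy, action, potentialEnergy, Submodule.coe_norm, L2_norm_sq, ← integral_vol hL,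
    ← integral_vol hL, ← integral_vol hL]
  congr 1
  · congr 1
    exact integral_congr_ae (by filter_upwards [hd] with t ht; rw [ht])
  · exact integral_congr_ae (by filter_upwards [hu] with t ht; rw [ht])

lemma energyDeriv_eq (hL : 0 ≤ L) {u v : ℝ → Vec n} {g h : derivSpace (n := n) α L hα'}
    (hu : u =ᵐ[vol L] leftInt α (g : Lp (Vec n) 2 (vol L)))
    (hud : leftDeriv α u =ᵐ[vol L] (g : Lp (Vec n) 2 (vol L)))
    (hv : v =ᵐ[vol L] leftInt α (h : Lp (Vec n) 2 (vol L)))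
    (hvd : leftDeriv α v =ᵐ[vol L] (h : Lp (Vec n) 2 (vol L))) :
    energyDeriv α L W u v = inner ℝ g h - potentialForce W g h := by
  rw [energyDeriv, potentialForce, Submodule.coe_inner, L2.inner_def, ← integral_vol hL,
    ← integral_vol hL, ← integral_vol hL]
  congr 1
  · exact integral_congr_ae (by filter_upwards [hud, hvd] with t h1 h2; rw [h1, h2])
  · exact integral_congr_ae (by filter_upwards [hu, hv] with t h1 h2; rw [h1, h2])

end GroundState

end FracBVP

theorem theorem4p1 (n : ℕ) (hn : 0 < n) (α : ℝ) (hα : 1 / 2 < α) (hα' : α < 1)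
    (L : ℝ) (hL : 0 < L) (θ : ℝ) (W : ℝ → FracBVP.Vec n → ℝ)
    (hW : FracBVP.Conditions L θ W) :
    ∃ u : ℝ → FracBVP.Vec n,
      FracBVP.IsSolution α L W u ∧ FracBVP.IsGroundState α L W u ∧
        FracBVP.energy α L W u = FracBVP.nehariLevel α L W := by
  open FracBVP in
  have := nontrivial_derivSpace (n := n) (α := α) (L := L) (hα' := hα') hn hα hL
  obtain ⟨g, hg0, hcrit, hmin⟩ :=
    (superquadratic_potentialEnergy (hα' := hα') hα hL hW hn).exists_groundState
  set u : ℝ → Vec n := leftInt α (g : Lp (Vec n) 2 (vol L)) with hu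
  have hud : leftDeriv α u =ᵐ[vol L] (g : Lp (Vec n) 2 (vol L)) :=
    leftDeriv_leftInt_ae_eq hα (hα' := hα') hL.le _
  have huc : ContinuousOn u (Icc 0 L) := continuousOn_path hα hL g
  have hf : ContinuousOn (fun t => ∇ (W t) (u t)) (Icc 0 L) :=
    hW.continuousOn_gradient_comp hL huc
  -- Criticality of `g` tested against the `L²` class of `leftDeriv α φ`, whose fractional integral
  -- is `φ` itself.
  have hweak : ∀ φ : ℝ → Vec n, IsTest L φ →
      ∫ t in (0 : ℝ)..L, inner ℝ ((g : Lp (Vec n) 2 (vol L)) t) (leftDeriv α φ t) =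
        ∫ t in (0 : ℝ)..L, inner ℝ (∇ (W t) (u t)) (φ t) := fun φ hφ => by
    have hm := hφ.memLp_leftDeriv hL.le hα'
    have hmem : hm.toLp _ ∈ derivSpace (n := n) α L hα' :=
      Submodule.le_topologicalClosure _ ⟨φ, hφ, hm.coeFn_toLp⟩
    have h1 := hcrit ⟨_, hmem⟩
    rw [Submodule.coe_inner, L2.inner_def, potentialForce] at h1
    rw [← integral_vol hL.le]
    refine Eq.trans (integral_congr_ae ?_) (h1.trans ?_)
    · filter_upwards [hm.coeFn_toLp] with t ht
      rw [ht]
    · refine intervalIntegral.integral_congr fun t ht => ?_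
      rw [uIcc_of_le hL.le] at ht
      simp only
      rw [leftInt_congr α hm.coeFn_toLp ht.1 ht.2, hφ.leftInt_leftDeriv (by linarith) hα' ht]
  have hreg := fun t (ht : t ∈ Ioo 0 L) => hasDerivAt_rightInt_of_weak hα hα' hL hf hweak ht
  have hne : ¬ (u =ᵐ[vol L] 0) := fun h =>
    hg0 (Subtype.ext ((leftInt_ae_eq_zero_iff hα (hα' := hα') hL.le _).1 h))
  have hmem : u ∈ E0 α L := leftInt_mem_E0 hα hL.le g.2
  have hcritical : ∀ v ∈ E0 α L, energyDeriv α L W u v = 0 := fun v hv => by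
    obtain ⟨h, hh, hv1, hv2⟩ := exists_leftInt_of_mem_E0 hα (hα' := hα') hL.le hv
    rw [energyDeriv_eq hL.le (g := g) (h := ⟨h, hh⟩) (EventuallyEq.refl _ _) hud hv1 hv2,
      hcrit, sub_self]
  have hleast : IsLeast (energy α L W '' nehari α L W) (energy α L W u) := by
    refine ⟨⟨u, ⟨hmem, hne, hcritical u hmem⟩, rfl⟩, ?_⟩
    rintro _ ⟨w, ⟨hw, hw0, hwN⟩, rfl⟩
    obtain ⟨h, hh, hw1, hw2⟩ := exists_leftInt_of_mem_E0 hα (hα' := hα') hL.le hw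
    rw [energyDeriv_eq hL.le (g := ⟨h, hh⟩) (h := ⟨h, hh⟩) hw1 hw2 hw1 hw2,
      real_inner_self_eq_norm_sq, sub_eq_zero] at hwN
    rw [energy_eq_action hL.le (g := g) (EventuallyEq.refl _ _) hud,
      energy_eq_action hL.le (g := ⟨h, hh⟩) hw1 hw2]
    refine hmin _ (fun h0 => hw0 (hw1.trans ?_)) hwN
    rw [leftInt_ae_eq_zero_iff hα (hα' := hα') hL.le]
    exact congrArg Subtype.val h0
  refine ⟨u, ⟨huc, ?_, leftInt_right_eq_zero hα hL.le g.2, fun t ht => (hreg t ht).1,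
    fun t ht => (hreg t ht).2.differentiableAt, fun t ht => ?_⟩,
    ⟨hmem, hne, hcritical, hleast⟩, hleast.csInf_eq.symm⟩
  · simp [hu, leftInt]
  · rw [rightDeriv, (hreg t ht).2.deriv, neg_neg]
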